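/- **Sub-gaussian notions.** A real random variable $x$ is sub-gaussian if there is $K>0$ with $(\mathbb E|x|^p)^{1/p}\le K\sqrt p$ for all $p\ge 1$; the smallest such $K$ is its sub-gaussian norm $\|x\|_{\Psi_2}$. A random vector $a\in\mathbb R^n$ is sub-gaussian if $a^Tv$ is sub-gaussian for every $v\in\mathbb R^n$, and its sub-gaussian norm is $\|a\|_{\Psi_2}=\sup_{\|v\|_2=1}\|a^Tv\|_{\Psi_2}$; it is isotropic if $\mathbb E\,aa^T=I_n$. **Setting.** Let $X_0\in\mathbb R^{d\times d}$ be a nonzero S&L matrix with parameters $(k,k,r)$, i.e. the smallest submatrix containing all nonzero entries of $X_0$ has size $k\times k$ and $\operatorname{rank}(X_0)=r$. Put $n=d^2$ and $\bar X_0=X_0/\|X_0\|_F$, let $\|X\|_1=\sum_{i,j}|X_{ij}|$ and let $\|X\|_\star$ be the nuclear norm (the sum of the singular values). Let $\mathcal A(X)=A\operatorname{vec}(X)$, where $A\in\mathbb R^{m\times n}$ is a random matrix with i.i.d. rows such that either 1. each row is a zero-mean isotropic sub-gaussian vector $a$ with $\|a\|_2=\sqrt n$ almost surely, or 2. each row has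 independent zero-mean unit-variance sub-gaussian entries. For $0\le\beta\le1$ let $f(X)=\beta\|X\|_1+(1-\beta)\sqrt d\,\|X\|_\star$ and $$m_{low}=\frac{\bigl(\beta\|\bar X_0\|_1+(1-\beta)\|\bar X_0\|_\star\sqrt d\bigr)^2}{2}.$$ **Claim.** For every $K$ there are constants $c_1,c_2>0$, depending only on $K$, such that the following holds for all $d,k,r,m,\beta$, all $X_0$ and all $A$ as above whose rows have sub-gaussian norm at most $K$. If $m\le\min\{m_{low},c_1n\}$, then with probability at least $1-4\exp(-c_2m_{low})$ the program $$\min_{X\in\mathbb R^{d\times d}} f(X)\quad\text{subject to}\quad \mathcal A(X)=\mathcal A(X_0)$$ fails, i.e. $X_0$ is not a minimizer of it. -/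

import Mathlib

open MeasureTheory ProbabilityTheory
open scoped ENNReal NNReal Matrix

noncomputable section

namespace SLRecovery

/-! ### Sub-gaussian random variables and vectors -/

section SubGaussian

variable {Ω : Type*} [MeasurableSpace Ω] {ι : Type*} [Fintype ι]

/-- `x` is sub-gaussian: for some `K > 0`, `(𝔼 |x|^p)^(1/p) ≤ K √p` for all real `p ≥ 1`. -/
def IsSubGaussian (x : Ω → ℝ) (μ : Measure Ω) : Prop :=
  ∃ K : ℝ≥0, 0 < K ∧ ∀ p : ℝ, 1 ≤ p →
    eLpNorm x (ENNReal.ofReal p) μ ≤ K * ENNReal.ofReal (√p)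

/-- The sub-gaussian norm: the smallest `K` with `(𝔼 |x|^p)^(1/p) ≤ K √p` for all `p ≥ 1`
(`⊤` if there is no finite one). -/
def subGaussianNorm (x : Ω → ℝ) (μ : Measure Ω) : ℝ≥0∞ :=
  sInf {K : ℝ≥0∞ | ∀ p : ℝ, 1 ≤ p →
    eLpNorm x (ENNReal.ofReal p) μ ≤ K * ENNReal.ofReal (√p)}

/-- A random vector is sub-gaussian if all its one-dimensional marginals are. -/
def IsSubGaussianVec (a : Ω → ι → ℝ) (μ : Measure Ω) : Prop :=
  ∀ v : ι → ℝ, IsSubGaussian (fun ω => a ω ⬝ᵥ v) μ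

/-- The sub-gaussian norm of a random vector: the supremum of the sub-gaussian norms of its
marginals in the directions of Euclidean norm one. -/
def subGaussianVecNorm (a : Ω → ι → ℝ) (μ : Measure Ω) : ℝ≥0∞ :=
  ⨆ (v : ι → ℝ) (_ : ‖WithLp.toLp 2 v‖ = 1), subGaussianNorm (fun ω => a ω ⬝ᵥ v) μ

/-- All coordinates have mean zero. -/
def IsZeroMean (a : Ω → ι → ℝ) (μ : Measure Ω) : Prop :=
  ∀ j, ∫ ω, a ω j ∂μ = 0

/-- `𝔼 [a aᵀ]` is the identity matrix. -/
def IsIsotropic [DecidableEq ι] (a : Ω → ι → ℝ) (μ : Measure Ω) : Prop :=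
  ∀ j k, ∫ ω, a ω j * a ω k ∂μ = (1 : Matrix ι ι ℝ) j k

/-- Zero-mean isotropic sub-gaussian vector whose Euclidean norm is almost surely the square
root of the dimension. -/
structure IsSphericalRow [DecidableEq ι] (a : Ω → ι → ℝ) (μ : Measure Ω) : Prop where
  subGaussian : IsSubGaussianVec a μ
  zeroMean : IsZeroMean a μ
  isotropic : IsIsotropic a μ
  norm_eq : ∀ᵐ ω ∂μ, ‖WithLp.toLp 2 (a ω)‖ = √(Fintype.card ι : ℝ)

/-- Vector with independent zero-mean unit-variance sub-gaussian entries. -/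
structure IsIndepEntriesRow (a : Ω → ι → ℝ) (μ : Measure Ω) : Prop where
  indep : iIndepFun (fun (j : ι) (ω : Ω) => a ω j) μ
  subGaussian : ∀ j, IsSubGaussian (fun ω => a ω j) μ
  zeroMean : IsZeroMean a μ
  unitVar : ∀ j, variance (fun ω => a ω j) μ = 1

/-- Random `m × ι` matrix with independent identically distributed rows, each of one of the two
forms above, and whose rows have sub-gaussian norm at most `K`. -/
structure IsSubGaussianMeasurement [DecidableEq ι] {m : ℕ} (A : Ω → Matrix (Fin m) ι ℝ)
    (μ : Measure Ω) (K : ℝ≥0) : Prop where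
  measurable : ∀ i, Measurable (fun ω => A ω i)
  indep : iIndepFun (fun (i : Fin m) (ω : Ω) => A ω i) μ
  identDistrib : ∀ i i', IdentDistrib (fun ω => A ω i) (fun ω => A ω i') μ μ
  form : (∀ i, IsSphericalRow (fun ω => A ω i) μ) ∨ (∀ i, IsIndepEntriesRow (fun ω => A ω i) μ)
  norm_le : ∀ i, subGaussianVecNorm (fun ω => A ω i) μ ≤ K

end SubGaussian

/-! ### Matrices -/

section Matrices

variable {d₁ d₂ : ℕ}

/-- `X` is an S&L matrix with `(k₁, k₂, r)`: the smallest submatrix containing all nonzero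
entries (formed by the nonzero rows and the nonzero columns) has size `k₁ × k₂`, and the rank of
`X` is `r`. -/
structure IsSLMatrix (X : Matrix (Fin d₁) (Fin d₂) ℝ) (k₁ k₂ r : ℕ) : Prop where
  rows : {i | ∃ j, X i j ≠ 0}.ncard = k₁
  cols : {j | ∃ i, X i j ≠ 0}.ncard = k₂
  rank_eq : X.rank = r

/-- The entrywise `ℓ₁` norm. -/
def l1Norm (X : Matrix (Fin d₁) (Fin d₂) ℝ) : ℝ := ∑ i, ∑ j, |X i j|

/-- The Frobenius norm. -/
def frobNorm (X : Matrix (Fin d₁) (Fin d₂) ℝ) : ℝ := √(∑ i, ∑ j, X i j ^ 2)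

/-- The nuclear norm: the sum of the singular values (those of index at least `d₂` vanish). -/
def nuclearNorm (X : Matrix (Fin d₁) (Fin d₂) ℝ) : ℝ :=
  ∑ i ∈ Finset.range d₂, (Matrix.toEuclideanLin X).singularValues i

/-- The normalization `X / ‖X‖_F`. -/
def normalized (X : Matrix (Fin d₁) (Fin d₂) ℝ) : Matrix (Fin d₁) (Fin d₂) ℝ :=
  (frobNorm X)⁻¹ • X

/-- The program "minimize `f X` subject to `A vec(X) = A vec(X₀)`" fails: `X₀` is not one of its
minimizers. -/
def ProgramFails {m : ℕ} (f : Matrix (Fin d₁) (Fin d₂) ℝ → ℝ)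
    (A : Matrix (Fin m) (Fin d₂ × Fin d₁) ℝ) (X₀ : Matrix (Fin d₁) (Fin d₂) ℝ) : Prop :=
  ¬ IsMinOn f {X | A *ᵥ X.vec = A *ᵥ X₀.vec} X₀

/-- The objective `β ‖X‖₁ + (1 - β) √d ‖X‖_⋆`. -/
def weightedObjective {d : ℕ} (β : ℝ) (X : Matrix (Fin d) (Fin d) ℝ) : ℝ :=
  β * l1Norm X + (1 - β) * √(d : ℝ) * nuclearNorm X

/-- `m_low = (β ‖X̄₀‖₁ + (1 - β) ‖X̄₀‖_⋆ √d)² / 2`. -/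
def mLow {d : ℕ} (β : ℝ) (X₀ : Matrix (Fin d) (Fin d) ℝ) : ℝ :=
  (β * l1Norm (normalized X₀) + (1 - β) * nuclearNorm (normalized X₀) * √(d : ℝ)) ^ 2 / 2

end Matrices

end SLRecovery

end

namespace SLRecovery

/-! ### Norm inequalities and the deterministic failure criterion -/

section MatrixNorms

variable {d₁ d₂ : ℕ}

/-! With too few measurements, the feasible point lying in the row space of `A` already beats `X₀`.
Normalize `X₀` to Frobenius norm one, put `b = A vec(X̄₀)`, and let `vec X = Aᵀy` with `A Aᵀ y = b`.
If `|Aᵀy|² ≥ σ|y|²` for all `y`, then `‖X‖_F² ≤ |b|²/σ`. The weight `√d` makes `f ≤ d‖·‖_F`, whereas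
`f(X̄₀)² = 2 m_low`; hence `d²|b|² < 2σ m_low` forces `f(X) < f(X̄₀)`
(`programFails_of_lower_bound`). The values `σ = 17/20 · n` and `|b|² < 17/10 · m_low` fit exactly.

Two probabilistic facts supply them. Since `|b|²` is a sum of `m ≤ m_low` independent squares of
mean one, a Chernoff bound controls it (`measure_mulVec_dotProduct_self_ge_le`). For `σ`, `|∑
yᵢaᵢ|²` concentrates around `n` for each fixed unit `y`, and a net of `101 ^ m` points suffices
because `m ≤ c₁n` (`measure_not_lower_bound_le`).

In the fixed-norm model the coordinates of a row may be dependent, so the concentration cannot come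
from a product over coordinates. Instead the exponential moment of `|∑ yᵢaᵢ|²` is built up row by
row (`lintegral_exp_sum_rows_le`), which needs only the bounds in `HasRowBounds`, common to both
models. -/

lemma frobNorm_nonneg (X : Matrix (Fin d₁) (Fin d₂) ℝ) : 0 ≤ frobNorm X := Real.sqrt_nonneg _

lemma sq_frobNorm (X : Matrix (Fin d₁) (Fin d₂) ℝ) :
    frobNorm X ^ 2 = ∑ i, ∑ j, X i j ^ 2 :=
  Real.sq_sqrt (Finset.sum_nonneg fun _ _ => Finset.sum_nonneg fun _ _ => sq_nonneg _)

lemma frobNorm_pos {X : Matrix (Fin d₁) (Fin d₂) ℝ} (hX : X ≠ 0) : 0 < frobNorm X := by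
  refine Real.sqrt_pos.2 (lt_of_le_of_ne
    (Finset.sum_nonneg fun _ _ => Finset.sum_nonneg fun _ _ => sq_nonneg _) fun h => hX ?_)
  ext i j
  have h1 := (Finset.sum_eq_zero_iff_of_nonneg
    (fun _ _ => Finset.sum_nonneg fun _ _ => sq_nonneg _)).1 h.symm i (Finset.mem_univ i)
  have h2 := (Finset.sum_eq_zero_iff_of_nonneg (fun _ _ => sq_nonneg _)).1 h1 j (Finset.mem_univ j)
  simpa using h2

lemma l1Norm_smul {c : ℝ} (hc : 0 ≤ c) (X : Matrix (Fin d₁) (Fin d₂) ℝ) :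
    l1Norm (c • X) = c * l1Norm X := by
  simp [l1Norm, abs_mul, abs_of_nonneg hc, Finset.mul_sum]

lemma l1Norm_le_frobNorm (X : Matrix (Fin d₁) (Fin d₂) ℝ) :
    l1Norm X ≤ √(d₁ * d₂ : ℝ) * frobNorm X := by
  rw [frobNorm, ← Real.sqrt_mul (by positivity)]
  refine Real.le_sqrt_of_sq_le ?_
  have h := sq_sum_le_card_mul_sum_sq (s := (Finset.univ : Finset (Fin d₁ × Fin d₂)))
    (f := fun p => |X p.1 p.2|)
  simpa [l1Norm, Fintype.sum_prod_type] using h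

/-- Comparing roots of characteristic polynomials identifies the eigenvalues as multisets, so their
ordering never has to be matched. -/
lemma sum_eigenvalues_smul {E : Type*} [NormedAddCommGroup E] [InnerProductSpace ℝ E]
    [FiniteDimensional ℝ E] {n : ℕ} (hn : Module.finrank ℝ E = n) {T T' : E →ₗ[ℝ] E}
    (hT : T.IsSymmetric) (hT' : T'.IsSymmetric) {c : ℝ} (h : T' = c • T) (g : ℝ → ℝ) :
    ∑ i, g (hT'.eigenvalues hn i) = ∑ i, g (c * hT.eigenvalues hn i) := by
  have hchar : T'.charpoly =
      ∏ i, (Polynomial.X - Polynomial.C (c * hT.eigenvalues hn i)) := by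
    rw [← LinearMap.charpoly_toMatrix T' (hT.eigenvectorBasis hn).toBasis, h, map_smul,
      hT.toMatrix_eigenvectorBasis hn, ← Matrix.diagonal_smul, Matrix.charpoly_diagonal]
    rfl
  have hroots : T'.charpoly.roots =
      Multiset.map (fun i => c * hT.eigenvalues hn i) Finset.univ.val := by
    rw [hchar, Polynomial.roots_prod _ _
      (Finset.prod_ne_zero_iff.2 fun i _ => Polynomial.X_sub_C_ne_zero _)]
    simp only [Polynomial.roots_X_sub_C, Multiset.bind_singleton]
  rw [hT'.roots_charpoly_eq_eigenvalues hn] at hroots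
  have := congrArg (fun s : Multiset ℝ => (s.map g).sum) hroots
  rw [Multiset.map_map, Multiset.map_map] at this
  exact this

lemma nuclearNorm_eq (X : Matrix (Fin d₁) (Fin d₂) ℝ) :
    nuclearNorm X = ∑ i : Fin d₂, √((Matrix.toEuclideanLin X).isSymmetric_adjoint_comp_self.eigenvalues
      (finrank_euclideanSpace_fin (𝕜 := ℝ) (n := d₂)) i) := by
  rw [nuclearNorm, Finset.sum_range]
  exact Finset.sum_congr rfl fun i _ => LinearMap.singularValues_fin _ _ i

lemma nuclearNorm_smul {c : ℝ} (hc : 0 ≤ c) (X : Matrix (Fin d₁) (Fin d₂) ℝ) :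
    nuclearNorm (c • X) = c * nuclearNorm X := by
  rw [nuclearNorm_eq, nuclearNorm_eq, sum_eigenvalues_smul (c := c ^ 2) _
    (Matrix.toEuclideanLin X).isSymmetric_adjoint_comp_self _ _ Real.sqrt, Finset.mul_sum]
  · refine Finset.sum_congr rfl fun i _ => ?_
    rw [Real.sqrt_mul (sq_nonneg c), Real.sqrt_sq hc]
  · simp [smul_smul, sq, LinearMap.comp_smul, LinearMap.smul_comp]

lemma sum_eigenvalues_adjoint_comp_self (X : Matrix (Fin d₁) (Fin d₂) ℝ) :
    ∑ i : Fin d₂, (Matrix.toEuclideanLin X).isSymmetric_adjoint_comp_self.eigenvalues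
      (finrank_euclideanSpace_fin (𝕜 := ℝ) (n := d₂)) i = frobNorm X ^ 2 := by
  have h := (Matrix.toEuclideanLin X).isSymmetric_adjoint_comp_self.trace_eq_sum_eigenvalues
      (finrank_euclideanSpace_fin (𝕜 := ℝ) (n := d₂))
  simp only [RCLike.ofReal_real_eq_id, id] at h
  rw [← h, sq_frobNorm, ← Matrix.toEuclideanLin_conjTranspose_eq_adjoint,
    LinearMap.trace_eq_matrix_trace ℝ (EuclideanSpace.basisFun (Fin d₂) ℝ).toBasis]
  rw [Finset.sum_comm]
  refine Finset.sum_congr rfl fun j _ => ?_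
  simp [LinearMap.toMatrix_apply, Matrix.toEuclideanLin, Matrix.mulVec, dotProduct, sq]

lemma nuclearNorm_le_frobNorm (X : Matrix (Fin d₁) (Fin d₂) ℝ) :
    nuclearNorm X ≤ √(d₂ : ℝ) * frobNorm X := by
  refine abs_le_of_sq_le_sq' ?_ (by positivity [frobNorm_nonneg X]) |>.2
  rw [mul_pow, Real.sq_sqrt (by positivity), ← sum_eigenvalues_adjoint_comp_self, nuclearNorm_eq]
  refine (sq_sum_le_card_mul_sum_sq).trans_eq ?_
  rw [Finset.card_univ, Fintype.card_fin]
  congr 1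
  refine Finset.sum_congr rfl fun i _ => Real.sq_sqrt ?_
  exact (Matrix.toEuclideanLin X).isPositive_adjoint_comp_self.nonneg_eigenvalues _ i

variable {d : ℕ}

lemma weightedObjective_smul (β : ℝ) {c : ℝ} (hc : 0 ≤ c) (X : Matrix (Fin d) (Fin d) ℝ) :
    weightedObjective β (c • X) = c * weightedObjective β X := by
  rw [weightedObjective, l1Norm_smul hc, nuclearNorm_smul hc, weightedObjective]
  ring

/-- By Cauchy–Schwarz the `ℓ₁` norm is at most `d‖X‖_F` and the nuclear norm at most `√d‖X‖_F`; the
weight `√d` equalizes the two bounds. -/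
lemma weightedObjective_le_frobNorm {β : ℝ} (h0 : 0 ≤ β) (h1 : β ≤ 1)
    (X : Matrix (Fin d) (Fin d) ℝ) : weightedObjective β X ≤ d * frobNorm X := by
  have hl := l1Norm_le_frobNorm X
  rw [Real.sqrt_mul_self (by positivity)] at hl
  have hn := mul_le_mul_of_nonneg_left (nuclearNorm_le_frobNorm X) (Real.sqrt_nonneg (d : ℝ))
  rw [← mul_assoc, Real.mul_self_sqrt (by positivity)] at hn
  rw [weightedObjective]
  have e1 := mul_le_mul_of_nonneg_left hl h0
  have e2 := mul_le_mul_of_nonneg_left hn (sub_nonneg.2 h1)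
  linarith

lemma nuclearNorm_nonneg (X : Matrix (Fin d₁) (Fin d₂) ℝ) : 0 ≤ nuclearNorm X :=
  Finset.sum_nonneg fun i _ => LinearMap.singularValues_nonneg _ i

lemma l1Norm_nonneg (X : Matrix (Fin d₁) (Fin d₂) ℝ) : 0 ≤ l1Norm X :=
  Finset.sum_nonneg fun _ _ => Finset.sum_nonneg fun _ _ => abs_nonneg _

lemma weightedObjective_nonneg {β : ℝ} (h0 : 0 ≤ β) (h1 : β ≤ 1)
    (X : Matrix (Fin d) (Fin d) ℝ) : 0 ≤ weightedObjective β X := by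
  have := l1Norm_nonneg X
  have := nuclearNorm_nonneg X
  have := sub_nonneg.2 h1
  rw [weightedObjective]
  positivity

lemma mLow_eq (β : ℝ) (X : Matrix (Fin d) (Fin d) ℝ) :
    mLow β X = weightedObjective β (normalized X) ^ 2 / 2 := by
  rw [mLow, weightedObjective]
  ring

lemma frobNorm_smul (c : ℝ) (X : Matrix (Fin d₁) (Fin d₂) ℝ) :
    frobNorm (c • X) = |c| * frobNorm X := by
  rw [frobNorm, frobNorm, ← Real.sqrt_sq_eq_abs, ← Real.sqrt_mul (sq_nonneg c)]
  simp [mul_pow, Finset.mul_sum]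

lemma frobNorm_normalized {X : Matrix (Fin d₁) (Fin d₂) ℝ} (hX : X ≠ 0) :
    frobNorm (normalized X) = 1 := by
  have h := frobNorm_pos hX
  rw [normalized, frobNorm_smul, abs_of_pos (inv_pos.2 h), inv_mul_cancel₀ h.ne']

lemma mLow_le {β : ℝ} (h0 : 0 ≤ β) (h1 : β ≤ 1) {X : Matrix (Fin d) (Fin d) ℝ} (hX : X ≠ 0) :
    mLow β X ≤ (d : ℝ) ^ 2 / 2 := by
  have h := weightedObjective_le_frobNorm h0 h1 (normalized X)
  rw [frobNorm_normalized hX, mul_one] at h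
  have := weightedObjective_nonneg h0 h1 (normalized X)
  rw [mLow_eq]
  gcongr

lemma vec_dotProduct_vec_self (X : Matrix (Fin d₁) (Fin d₂) ℝ) :
    X.vec ⬝ᵥ X.vec = frobNorm X ^ 2 := by
  rw [sq_frobNorm, Finset.sum_comm]
  simp [dotProduct, Matrix.vec, Fintype.sum_prod_type, sq]

/-- The program fails once `Aᵀ` is bounded below and the measurements of the normalized matrix are
short: the point of the row space of `A` with the same measurements as `X₀` has a smaller
objective. -/
lemma programFails_of_lower_bound {m : ℕ} {β σ : ℝ} (h0 : 0 ≤ β) (h1 : β ≤ 1) (hσ : 0 < σ)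
    {X₀ : Matrix (Fin d) (Fin d) ℝ} (hX : X₀ ≠ 0) (A : Matrix (Fin m) (Fin d × Fin d) ℝ)
    (hA : ∀ y : Fin m → ℝ, σ * (y ⬝ᵥ y) ≤ (y ᵥ* A) ⬝ᵥ (y ᵥ* A))
    (hlt : (d : ℝ) ^ 2 * ((A *ᵥ (normalized X₀).vec) ⬝ᵥ (A *ᵥ (normalized X₀).vec)) <
      2 * mLow β X₀ * σ) :
    ProgramFails (weightedObjective β) A X₀ := by
  set X₁ := normalized X₀ with hX₁
  have hF := frobNorm_pos hX
  have hX₀ : X₀ = frobNorm X₀ • X₁ := by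
    rw [hX₁, normalized, smul_smul, mul_inv_cancel₀ hF.ne', one_smul]
  have hinj : Function.Injective (A * Aᵀ).mulVecLin := by
    rw [← LinearMap.ker_eq_bot, LinearMap.ker_eq_bot']
    intro y hy
    rw [Matrix.mulVecLin_apply] at hy
    have h2 : (y ᵥ* A) ⬝ᵥ (y ᵥ* A) = 0 := by
      rw [← Matrix.dotProduct_mulVec, ← Matrix.mulVec_transpose, Matrix.mulVec_mulVec, hy,
        dotProduct_zero]
    have h3 := hA y
    rw [h2] at h3
    have h4 : 0 ≤ y ⬝ᵥ y := Finset.sum_nonneg fun i _ => mul_self_nonneg _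
    exact dotProduct_self_eq_zero.1 (le_antisymm (nonpos_of_mul_nonpos_right h3 hσ) h4)
  obtain ⟨y, hy⟩ := (LinearMap.injective_iff_surjective.1 hinj) (A *ᵥ X₁.vec)
  rw [Matrix.mulVecLin_apply, ← Matrix.mulVec_mulVec, Matrix.mulVec_transpose] at hy
  obtain ⟨X, hXv⟩ : ∃ X : Matrix (Fin d) (Fin d) ℝ, X.vec = y ᵥ* A :=
    ⟨Matrix.of fun i j => (y ᵥ* A) (j, i), by ext ⟨i, j⟩; simp [Matrix.vec]⟩
  have hsq : frobNorm X ^ 2 = y ⬝ᵥ (A *ᵥ X₁.vec) := by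
    rw [← vec_dotProduct_vec_self, hXv, ← Matrix.dotProduct_mulVec, hy]
  have hlow := hA y
  rw [← hXv, vec_dotProduct_vec_self] at hlow
  set b := A *ᵥ X₁.vec with hb
  -- Expand `|σy - b|² ≥ 0` and use `σ|y|² ≤ ‖X‖_F² = y·b`.
  have hbound : σ * frobNorm X ^ 2 ≤ b ⬝ᵥ b := by
    have h := dotProduct_self_star_nonneg (σ • y - b)
    simp only [star_trivial, sub_dotProduct, dotProduct_sub, smul_dotProduct, dotProduct_smul,
      smul_eq_mul, ← hsq, dotProduct_comm b y] at h
    nlinarith [mul_le_mul_of_nonneg_left hlow hσ.le]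
  have hlt' : weightedObjective β X < weightedObjective β X₁ := by
    have hw := weightedObjective_le_frobNorm h0 h1 X
    refine hw.trans_lt (abs_lt_of_sq_lt_sq' ?_ (weightedObjective_nonneg h0 h1 _)).2
    rw [mLow_eq, ← hX₁] at hlt
    refine lt_of_mul_lt_mul_right (a := σ) ?_ hσ.le
    calc (d * frobNorm X) ^ 2 * σ = (d : ℝ) ^ 2 * (σ * frobNorm X ^ 2) := by ring
      _ ≤ (d : ℝ) ^ 2 * (b ⬝ᵥ b) := by gcongr
      _ < _ := by rw [hb]; linarith
  intro hmin
  have hfeas : frobNorm X₀ • X ∈ {X | A *ᵥ X.vec = A *ᵥ X₀.vec} := by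
    rw [Set.mem_ofPred_eq]
    conv_rhs => rw [hX₀]
    rw [Matrix.vec_smul, Matrix.vec_smul, Matrix.mulVec_smul, Matrix.mulVec_smul, hXv, hy]
  have := hmin hfeas
  simp only [Set.mem_ofPred_eq] at this
  conv_lhs at this => rw [hX₀]
  rw [weightedObjective_smul β hF.le, weightedObjective_smul β hF.le] at this
  nlinarith

end MatrixNorms

end SLRecovery

namespace SLRecovery

/-! ### Nets on the sphere and passage from a net to all vectors -/

section Nets

variable {E : Type*} [NormedAddCommGroup E] [NormedSpace ℝ E] [FiniteDimensional ℝ E]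

open Module Metric in
open scoped Function in
/-- Any `δ`-separated set in the unit ball has cardinality at most `(1 + 2 / δ) ^ dim`. -/
lemma card_le_of_separated_unitBall {δ : ℝ} (hδ : 0 < δ) (s : Finset E) (hs : ∀ c ∈ s, ‖c‖ ≤ 1)
    (h : ∀ c ∈ s, ∀ d ∈ s, c ≠ d → δ ≤ ‖c - d‖) :
    (s.card : ℝ) ≤ (1 + 2 / δ) ^ finrank ℝ E := by
  borelize E
  let μ : Measure E := Measure.addHaar
  have hδ2 : 0 < δ / 2 := by positivity
  have ρpos : 0 < 1 + δ / 2 := by positivity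
  have D : Set.Pairwise (s : Set E) (Disjoint on fun c => ball (c : E) (δ / 2)) := by
    rintro c hc d hd hcd
    apply ball_disjoint_ball
    rw [dist_eq_norm, add_halves]
    exact h c hc d hd hcd
  have A_subset : (⋃ c ∈ s, ball (c : E) (δ / 2)) ⊆ ball (0 : E) (1 + δ / 2) := by
    refine Set.iUnion₂_subset fun x hx => ball_subset_ball' ?_
    rw [dist_zero_right, add_comm]
    exact add_le_add_left (hs x hx) _
  have I : (s.card : ℝ≥0∞) * ENNReal.ofReal ((δ / 2) ^ finrank ℝ E) * μ (ball 0 1) ≤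
      ENNReal.ofReal ((1 + δ / 2) ^ finrank ℝ E) * μ (ball 0 1) := by
    rw [← μ.addHaar_ball_of_pos (0 : E) ρpos]
    refine le_trans (le_of_eq ?_) (measure_mono A_subset)
    rw [measure_biUnion_finset D fun c _ => measurableSet_ball]
    simp only [μ.addHaar_ball_of_pos _ hδ2, Finset.sum_const, nsmul_eq_mul, mul_assoc]
  have J := (ENNReal.mul_le_mul_iff_left (measure_ball_pos μ _ zero_lt_one).ne'
    measure_ball_lt_top.ne).1 I
  have K := ENNReal.toReal_le_of_le_ofReal (pow_nonneg ρpos.le _) J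
  rw [ENNReal.toReal_mul, ENNReal.toReal_natCast, ENNReal.toReal_ofReal (by positivity),
    ← le_div_iff₀ (by positivity), ← div_pow] at K
  rwa [show (1 + δ / 2) / (δ / 2) = 1 + 2 / δ by field_simp; ring] at K

open Module in
-- A `δ`-separated subset of the sphere of maximal cardinality is a net, and the volume bound
-- guarantees that a maximum exists.
lemma exists_net_unitSphere {δ : ℝ} (hδ : 0 < δ) :
    ∃ N : Finset E, (N.card : ℝ) ≤ (1 + 2 / δ) ^ finrank ℝ E ∧ (∀ c ∈ N, ‖c‖ = 1) ∧
      ∀ x : E, ‖x‖ = 1 → ∃ c ∈ N, ‖x - c‖ ≤ δ := by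
  classical
  let P : Finset E → Prop := fun s =>
    (∀ c ∈ s, ‖c‖ = 1) ∧ ∀ c ∈ s, ∀ d ∈ s, c ≠ d → δ ≤ ‖c - d‖
  have hcard : ∀ s, P s → (s.card : ℝ) ≤ (1 + 2 / δ) ^ finrank ℝ E := fun s hs =>
    card_le_of_separated_unitBall hδ s (fun c hc => (hs.1 c hc).le) hs.2
  let S : Set ℕ := {n | ∃ s, P s ∧ s.card = n}
  have hSne : S.Nonempty := ⟨0, ∅, by simp [P], rfl⟩
  have hSb : BddAbove S := by
    refine ⟨⌊(1 + 2 / δ) ^ finrank ℝ E⌋₊, ?_⟩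
    rintro _ ⟨s, hs, rfl⟩
    exact Nat.le_floor (hcard s hs)
  obtain ⟨N, hN, hNc⟩ := Nat.sSup_mem hSne hSb
  refine ⟨N, hcard N hN, hN.1, fun x hx => ?_⟩
  by_contra! hfar
  have hxN : x ∉ N := fun hxN => by
    have := hfar x hxN
    simp only [sub_self, norm_zero] at this
    linarith
  have hP : P (insert x N) := by
    refine ⟨?_, ?_⟩
    · intro c hc
      rcases Finset.mem_insert.1 hc with rfl | hc
      exacts [hx, hN.1 c hc]
    · intro c hc d hd hcd
      rcases Finset.mem_insert.1 hc with rfl | hc' <;> rcases Finset.mem_insert.1 hd with rfl | hd'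
      · exact absurd rfl hcd
      · exact (hfar d hd').le
      · rw [norm_sub_rev]
        exact (hfar c hc').le
      · exact hN.2 c hc' d hd' hcd
  have := le_csSup hSb ⟨_, hP, rfl⟩
  rw [Finset.card_insert_of_notMem hxN, hNc] at this
  omega

/-- The upper bound on the net is needed as well: it controls `‖T‖`, hence the error made in
replacing a unit vector by a net point. -/
lemma lower_bound_of_net {E F : Type*} [NormedAddCommGroup E] [NormedSpace ℝ E]
    [NormedAddCommGroup F] [NormedSpace ℝ F] (T : E →L[ℝ] F)
    {a : ℝ} (ha : 0 ≤ a) {N : Finset E} (hN : ∀ x : E, ‖x‖ = 1 → ∃ c ∈ N, ‖x - c‖ ≤ 1 / 50)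
    (hT : ∀ c ∈ N, 9 / 10 * a ^ 2 ≤ ‖T c‖ ^ 2 ∧ ‖T c‖ ^ 2 ≤ 11 / 10 * a ^ 2) (y : E) :
    17 / 20 * a ^ 2 * ‖y‖ ^ 2 ≤ ‖T y‖ ^ 2 := by
  have hub : ∀ c ∈ N, ‖T c‖ ≤ 21 / 20 * a := fun c hc =>
    (abs_le_of_sq_le_sq' (by nlinarith [(hT c hc).2, sq_nonneg a]) (by positivity)).2
  have hlb : ∀ c ∈ N, 189 / 200 * a ≤ ‖T c‖ := fun c hc =>
    (abs_le_of_sq_le_sq' (by nlinarith [(hT c hc).1, sq_nonneg a]) (by positivity)).2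
  have hunit : ∀ x : E, ‖x‖ = 1 →
      ‖T x‖ ≤ 21 / 20 * a + ‖T‖ / 50 ∧ 189 / 200 * a - ‖T‖ / 50 ≤ ‖T x‖ := by
    intro x hx
    obtain ⟨c, hc, hxc⟩ := hN x hx
    have h1 : ‖T x - T c‖ ≤ ‖T‖ / 50 := by
      rw [← map_sub]
      refine (T.le_opNorm _).trans ?_
      have := mul_le_mul_of_nonneg_left hxc (norm_nonneg T)
      linarith
    have h2 := norm_sub_norm_le (T x) (T c)
    have h3 := norm_sub_norm_le (T c) (T x)
    rw [norm_sub_rev] at h3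
    constructor <;> linarith [hub c hc, hlb c hc]
  have hscale : ∀ x : E, x ≠ 0 → ‖T x‖ = ‖x‖ * ‖T (‖x‖⁻¹ • x)‖ ∧ ‖‖x‖⁻¹ • x‖ = 1 := by
    intro x hx
    have hx' : 0 < ‖x‖ := norm_pos_iff.2 hx
    rw [map_smul, norm_smul, norm_smul, norm_inv, norm_norm]
    constructor <;> field_simp
  -- Self-bounding: absorbing `‖T‖ / 50` on the left gives `‖T‖ ≤ 15/14 · a`.
  have hop : ‖T‖ ≤ 21 / 20 * a + ‖T‖ / 50 := by
    refine T.opNorm_le_bound (by positivity) fun x => ?_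
    rcases eq_or_ne x 0 with rfl | hx
    · simp
    · rw [(hscale x hx).1, mul_comm]
      exact mul_le_mul_of_nonneg_right (hunit _ (hscale x hx).2).1 (norm_nonneg _)
  rcases eq_or_ne y 0 with rfl | hy
  · simp
  · rw [(hscale y hy).1, mul_pow, mul_comm]
    refine mul_le_mul_of_nonneg_left ?_ (sq_nonneg _)
    have h1 : 923 / 1000 * a ≤ ‖T (‖y‖⁻¹ • y)‖ := by
      linarith [(hunit _ (hscale y hy).2).2]
    have := pow_le_pow_left₀ (by positivity) h1 2
    nlinarith [sq_nonneg a]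

end Nets

section Matrices

lemma norm_toLp_sq {ι : Type*} [Fintype ι] (v : ι → ℝ) : ‖WithLp.toLp 2 v‖ ^ 2 = v ⬝ᵥ v := by
  rw [EuclideanSpace.real_norm_sq_eq]
  simp [dotProduct, sq]

lemma exists_net_vecMul (m : ℕ) : ∃ N : Finset (Fin m → ℝ), (N.card : ℝ) ≤ 101 ^ m ∧
    (∀ y ∈ N, y ⬝ᵥ y = 1) ∧ ∀ {ι : Type} [Fintype ι] (A : Matrix (Fin m) ι ℝ) (n : ℝ), 0 ≤ n →
      (∀ y ∈ N, 9 / 10 * n ≤ (y ᵥ* A) ⬝ᵥ (y ᵥ* A) ∧ (y ᵥ* A) ⬝ᵥ (y ᵥ* A) ≤ 11 / 10 * n) →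
      ∀ y, 17 / 20 * n * (y ⬝ᵥ y) ≤ (y ᵥ* A) ⬝ᵥ (y ᵥ* A) := by
  classical
  obtain ⟨N, hcard, hunit, hcover⟩ :=
    exists_net_unitSphere (E := EuclideanSpace ℝ (Fin m)) (δ := 1 / 50) (by norm_num)
  refine ⟨N.image WithLp.ofLp, ?_, ?_, ?_⟩
  · refine le_trans (Nat.cast_le.2 Finset.card_image_le) (hcard.trans_eq ?_)
    rw [finrank_euclideanSpace_fin]
    norm_num
  · intro y hy
    obtain ⟨c, hc, rfl⟩ := Finset.mem_image.1 hy
    rw [← norm_toLp_sq, WithLp.toLp_ofLp, hunit c hc, one_pow]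
  · intro ι _ A n hn hA y
    let T : EuclideanSpace ℝ (Fin m) →L[ℝ] EuclideanSpace ℝ ι :=
      LinearMap.toContinuousLinearMap (Matrix.toEuclideanLin Aᵀ)
    have hT : ∀ y : Fin m → ℝ, ‖T (WithLp.toLp 2 y)‖ ^ 2 = (y ᵥ* A) ⬝ᵥ (y ᵥ* A) := by
      intro y
      rw [← norm_toLp_sq, ← Matrix.mulVec_transpose]
      rfl
    have h := lower_bound_of_net T (Real.sqrt_nonneg n) hcover (fun c hc => ?_) (WithLp.toLp 2 y)
    · rwa [Real.sq_sqrt hn, hT, norm_toLp_sq] at h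
    · have := hA c.ofLp (Finset.mem_image_of_mem _ hc)
      rw [Real.sq_sqrt hn, ← WithLp.toLp_ofLp 2 c, hT]
      exact this

end Matrices

end SLRecovery

namespace SLRecovery

/-! ### Exponential moments of a sub-gaussian variable and of its square -/

section Scalar

variable {Ω : Type*} [MeasurableSpace Ω] {μ : Measure Ω} {K : ℝ≥0} {Z : Ω → ℝ}

/-- The scale on which the square of a random variable of sub-gaussian norm at most `K` has
exponential moments. -/
noncomputable def subExpScale (K : ℝ≥0) : ℝ := 2 * Real.exp 1 * ((K : ℝ) + 1) ^ 2

lemma one_le_subExpScale (K : ℝ≥0) : 1 ≤ subExpScale K := by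
  have h1 : (1 : ℝ) ≤ Real.exp 1 := Real.one_le_exp zero_le_one
  have h2 : (1 : ℝ) ≤ ((K : ℝ) + 1) ^ 2 := one_le_pow₀ (by simp)
  rw [subExpScale]
  nlinarith

lemma lintegral_even_pow_le (h : subGaussianNorm Z μ ≤ K) {q : ℕ} (hq : 1 ≤ q) :
    ∫⁻ ω, ENNReal.ofReal (Z ω ^ (2 * q)) ∂μ ≤
      ENNReal.ofReal ((((K : ℝ) + 1) ^ 2 * (2 * q)) ^ q) := by
  -- The slack `+ 1` yields an admissible constant without showing that the infimum is attained.
  have hlt : subGaussianNorm Z μ < (K : ℝ≥0∞) + 1 :=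
    h.trans_lt (ENNReal.lt_add_right ENNReal.coe_ne_top one_ne_zero)
  obtain ⟨L, hL, hLK⟩ := sInf_lt_iff.1 hlt
  have hq' : (1 : ℝ) ≤ q := by exact_mod_cast hq
  have hp : (0 : ℝ) < 2 * q := by linarith
  have h1 := (hL (2 * q) (by linarith)).trans (mul_le_mul_left hLK.le _)
  rw [eLpNorm_eq_lintegral_rpow_enorm_toReal (ENNReal.ofReal_pos.2 hp).ne' ENNReal.ofReal_ne_top,
    ENNReal.toReal_ofReal hp.le, one_div, ENNReal.rpow_inv_le_iff hp] at h1
  have e1 : ∀ ω, ENNReal.ofReal (Z ω ^ (2 * q)) = ‖Z ω‖ₑ ^ (2 * q : ℝ) := by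
    intro ω
    rw [← (even_two_mul q).pow_abs, ENNReal.ofReal_pow (abs_nonneg _),
      ← Real.enorm_eq_ofReal_abs, ← ENNReal.rpow_natCast]
    norm_num
  have e2 : ((K : ℝ≥0∞) + 1) * ENNReal.ofReal √(2 * q) =
      ENNReal.ofReal (((K : ℝ) + 1) * √(2 * q)) := by
    rw [ENNReal.ofReal_mul (by positivity), ENNReal.ofReal_add (by positivity) zero_le_one]
    simp
  simp_rw [e1]
  refine h1.trans_eq ?_
  rw [e2, show (2 * q : ℝ) = ((2 * q : ℕ) : ℝ) by push_cast; rfl, ENNReal.rpow_natCast,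
    ← ENNReal.ofReal_pow (by positivity), pow_mul, mul_pow, Real.sq_sqrt (by positivity)]

lemma hasSum_exp_sub_one_sub (x : ℝ) :
    HasSum (fun q : ℕ => x ^ (q + 2) / (q + 2).factorial) (Real.exp x - 1 - x) := by
  have h := NormedSpace.expSeries_div_hasSum_exp (𝔸 := ℝ) x
  rw [← Real.exp_eq_exp_ℝ, ← hasSum_nat_add_iff' 2] at h
  rw [Finset.sum_range_succ, Finset.sum_range_one] at h
  rwa [show Real.exp x - (x ^ 0 / (Nat.factorial 0 : ℝ) + x ^ 1 / (Nat.factorial 1 : ℝ)) =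
    Real.exp x - 1 - x by norm_num; ring] at h

/-- Expand the exponential and integrate termwise: the moment bound together with `q ^ q / q! ≤ e ^
q` leaves a geometric series of ratio at most `1/2`. -/
lemma lintegral_exp_sub_one_sub_le (hZ : Measurable Z) (h : subGaussianNorm Z μ ≤ K) {s : ℝ}
    (hs : subExpScale K * |s| ≤ 1 / 2) :
    ∫⁻ ω, ENNReal.ofReal (Real.exp (|s| * Z ω ^ 2) - 1 - |s| * Z ω ^ 2) ∂μ ≤
      ENNReal.ofReal (2 * (subExpScale K * s) ^ 2) := by
  set κ := subExpScale K with hκ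
  have hκ1 := one_le_subExpScale K
  set x := κ * |s| with hx
  have hx0 : 0 ≤ x := by positivity
  have e1 : ∀ ω, ENNReal.ofReal (Real.exp (|s| * Z ω ^ 2) - 1 - |s| * Z ω ^ 2) =
      ∑' q : ℕ, ENNReal.ofReal (|s| ^ (q + 2) / (q + 2).factorial) *
        ENNReal.ofReal (Z ω ^ (2 * (q + 2))) := by
    intro ω
    have hsum := hasSum_exp_sub_one_sub (|s| * Z ω ^ 2)
    rw [← hsum.tsum_eq, ENNReal.ofReal_tsum_of_nonneg (fun q => by positivity) hsum.summable]
    refine tsum_congr fun q => ?_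
    rw [← ENNReal.ofReal_mul (by positivity), mul_pow, ← pow_mul]
    congr 1
    ring
  simp_rw [e1]
  rw [lintegral_tsum (fun q => by fun_prop)]
  have hterm : ∀ q : ℕ, ∫⁻ ω, ENNReal.ofReal (|s| ^ (q + 2) / (q + 2).factorial) *
      ENNReal.ofReal (Z ω ^ (2 * (q + 2))) ∂μ ≤ ENNReal.ofReal (x ^ 2 * x ^ q) := by
    intro q
    rw [lintegral_const_mul _ (by fun_prop)]
    refine (mul_le_mul_right (lintegral_even_pow_le h (by omega)) _).trans ?_
    rw [← ENNReal.ofReal_mul (by positivity)]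
    refine ENNReal.ofReal_le_ofReal ?_
    have hfac := Real.pow_div_factorial_le_exp ((q + 2 : ℕ) : ℝ) (by positivity) (q + 2)
    rw [← Real.exp_one_rpow, Real.rpow_natCast] at hfac
    calc |s| ^ (q + 2) / (q + 2).factorial * (((K : ℝ) + 1) ^ 2 * (2 * ((q + 2 : ℕ) : ℝ))) ^ (q + 2)
        = (|s| * (((K : ℝ) + 1) ^ 2 * 2)) ^ (q + 2) *
          (((q + 2 : ℕ) : ℝ) ^ (q + 2) / (q + 2).factorial) := by
          rw [mul_pow, mul_pow, mul_pow, mul_pow]; ring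
      _ ≤ (|s| * (((K : ℝ) + 1) ^ 2 * 2)) ^ (q + 2) * Real.exp 1 ^ (q + 2) := by gcongr
      _ = x ^ 2 * x ^ q := by
          rw [← mul_pow, ← pow_add, add_comm 2 q, hx, hκ, subExpScale]
          congr 1
          ring
  refine (ENNReal.tsum_le_tsum hterm).trans ?_
  have hgeo := (hasSum_geometric_of_lt_one hx0 (by linarith)).mul_left (x ^ 2)
  rw [← ENNReal.ofReal_tsum_of_nonneg (fun q => by positivity) hgeo.summable, hgeo.tsum_eq]
  refine ENNReal.ofReal_le_ofReal ?_
  have h2 : (1 - x)⁻¹ ≤ 2 := by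
    rw [inv_le_comm₀ (by linarith) two_pos]
    linarith
  calc x ^ 2 * (1 - x)⁻¹ ≤ x ^ 2 * 2 := by gcongr
    _ = 2 * (κ * s) ^ 2 := by rw [hx, mul_pow, mul_pow, sq_abs]; ring

lemma exp_le_one_add_self_add_abs (u : ℝ) :
    Real.exp u ≤ 1 + u + (Real.exp |u| - 1 - |u|) := by
  rcases le_total 0 u with hu | hu
  · rw [abs_of_nonneg hu]
    linarith
  · have h := Real.self_le_sinh_iff.2 (neg_nonneg.2 hu)
    rw [Real.sinh_eq, neg_neg] at h
    rw [abs_of_nonpos hu]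
    linarith

lemma exp_le_self_add_exp_sq (x : ℝ) : Real.exp x ≤ x + Real.exp (x ^ 2) := by
  have h := Real.add_one_le_exp (x ^ 2)
  by_cases hx : |x| ≤ 1
  · have := (abs_le.1 (Real.abs_exp_sub_one_sub_id_le hx)).2
    linarith
  · rcases lt_abs.1 (not_le.1 hx) with hx | hx
    · have : Real.exp x ≤ Real.exp (x ^ 2) := Real.exp_le_exp.2 (by nlinarith)
      linarith
    · have : Real.exp x ≤ 1 := Real.exp_le_one_iff.2 (by linarith)
      nlinarith

lemma ofReal_integral_le_lintegral {f : Ω → ℝ} {c : ℝ} (hf : Integrable f μ) (h0 : ∀ ω, 0 ≤ f ω)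
    (h : ∫ ω, f ω ∂μ ≤ c) : ∫⁻ ω, ENNReal.ofReal (f ω) ∂μ ≤ ENNReal.ofReal c := by
  rw [← ofReal_integral_eq_lintegral_ofReal hf (ae_of_all _ h0)]
  exact ENNReal.ofReal_le_ofReal h

variable [IsProbabilityMeasure μ]

/-- The first-order term is exactly `s` because the second moment is one; only the quadratic
remainder depends on `K`. -/
lemma integral_exp_mul_sq_le (hZ : Measurable Z) (hsq : ∫ ω, Z ω ^ 2 ∂μ = 1)
    (h : subGaussianNorm Z μ ≤ K) {s : ℝ} (hs : subExpScale K * |s| ≤ 1 / 2) :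
    Integrable (fun ω => Real.exp (s * Z ω ^ 2)) μ ∧
      ∫ ω, Real.exp (s * Z ω ^ 2) ∂μ ≤ Real.exp (s + 2 * (subExpScale K * s) ^ 2) := by
  have hsqi : Integrable (fun ω => Z ω ^ 2) μ := integrable_of_integral_eq_one hsq
  have hl := lintegral_exp_sub_one_sub_le hZ h hs
  set R : Ω → ℝ := fun ω => Real.exp (|s| * Z ω ^ 2) - 1 - |s| * Z ω ^ 2
  have hR0 : ∀ ω, 0 ≤ R ω := fun ω => by
    have := Real.add_one_le_exp (|s| * Z ω ^ 2)
    simp only [R]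
    linarith
  have hRm : Measurable R := by fun_prop
  have hRi : Integrable R μ := by
    refine ⟨hRm.aestronglyMeasurable, ?_⟩
    rw [hasFiniteIntegral_iff_ofReal (ae_of_all _ hR0)]
    exact hl.trans_lt ENNReal.ofReal_lt_top
  have hRle : ∫ ω, R ω ∂μ ≤ 2 * (subExpScale K * s) ^ 2 := by
    rw [integral_eq_lintegral_of_nonneg_ae (ae_of_all _ hR0) hRm.aestronglyMeasurable]
    exact ENNReal.toReal_le_of_le_ofReal (by positivity) hl
  have hdom : Integrable (fun ω => 1 + s * Z ω ^ 2 + R ω) μ :=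
    ((integrable_const _).add (hsqi.const_mul s)).add hRi
  have hle : ∀ ω, Real.exp (s * Z ω ^ 2) ≤ 1 + s * Z ω ^ 2 + R ω := fun ω => by
    have := exp_le_one_add_self_add_abs (s * Z ω ^ 2)
    rwa [abs_mul, abs_of_nonneg (sq_nonneg (Z ω))] at this
  have hint : Integrable (fun ω => Real.exp (s * Z ω ^ 2)) μ := by
    refine hdom.mono' (by fun_prop) (ae_of_all _ fun ω => ?_)
    rw [Real.norm_of_nonneg (Real.exp_nonneg _)]
    exact hle ω
  refine ⟨hint, (integral_mono hint hdom hle).trans ?_⟩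
  have hlin : Integrable (fun ω => 1 + s * Z ω ^ 2) μ :=
    (integrable_const _).add (hsqi.const_mul s)
  rw [integral_add hlin hRi,
    integral_add (integrable_const _) (hsqi.const_mul s), integral_const_mul, hsq]
  simp only [integral_const, probReal_univ, smul_eq_mul, mul_one]
  have := Real.add_one_le_exp (s + 2 * (subExpScale K * s) ^ 2)
  linarith

/-- For small `t`, `e ^ x ≤ x + e ^ (x²)` and the zero mean reduce to the moment of `Z²`. For large
`t`, the inequality `tZ ≤ κt² + Z²/(4κ)` does. -/
lemma integral_exp_mul_le (hZ : Measurable Z) (hmean : ∫ ω, Z ω ∂μ = 0)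
    (hsq : ∫ ω, Z ω ^ 2 ∂μ = 1) (h : subGaussianNorm Z μ ≤ K) (t : ℝ) :
    Integrable (fun ω => Real.exp (t * Z ω)) μ ∧
      ∫ ω, Real.exp (t * Z ω) ∂μ ≤ Real.exp (2 * subExpScale K * t ^ 2) := by
  have hκ1 := one_le_subExpScale K
  set κ := subExpScale K
  have hsqi : Integrable (fun ω => Z ω ^ 2) μ := integrable_of_integral_eq_one hsq
  have hZi : Integrable Z μ :=
    ((memLp_two_iff_integrable_sq hZ.aestronglyMeasurable).2 hsqi).integrable one_le_two
  by_cases ht : κ * t ^ 2 ≤ 1 / 2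
  · obtain ⟨hi, hle⟩ := integral_exp_mul_sq_le (s := t ^ 2) hZ hsq h
      (by rwa [abs_of_nonneg (sq_nonneg t)])
    have hdom : Integrable (fun ω => t * Z ω + Real.exp (t ^ 2 * Z ω ^ 2)) μ :=
      (hZi.const_mul t).add hi
    have hpt : ∀ ω, Real.exp (t * Z ω) ≤ t * Z ω + Real.exp (t ^ 2 * Z ω ^ 2) := fun ω => by
      have := exp_le_self_add_exp_sq (t * Z ω)
      rwa [mul_pow] at this
    have hint : Integrable (fun ω => Real.exp (t * Z ω)) μ := by
      refine hdom.mono' (by fun_prop) (ae_of_all _ fun ω => ?_)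
      rw [Real.norm_of_nonneg (Real.exp_nonneg _)]
      exact hpt ω
    refine ⟨hint, (integral_mono hint hdom hpt).trans ?_⟩
    rw [integral_add (hZi.const_mul t) hi, integral_const_mul, hmean, mul_zero, zero_add]
    refine hle.trans (Real.exp_le_exp.2 ?_)
    nlinarith [mul_le_mul_of_nonneg_left ht (by positivity : 0 ≤ κ * t ^ 2),
      mul_le_mul_of_nonneg_right hκ1 (sq_nonneg t)]
  · have hκ0 : 0 < κ := by linarith
    obtain ⟨hi, hle⟩ := integral_exp_mul_sq_le (s := 1 / (4 * κ)) hZ hsq h (by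
      rw [abs_of_pos (by positivity)]
      change κ * _ ≤ _
      field_simp
      norm_num)
    have hpt : ∀ ω, Real.exp (t * Z ω) ≤
        Real.exp (κ * t ^ 2) * Real.exp (1 / (4 * κ) * Z ω ^ 2) := fun ω => by
      rw [← Real.exp_add, Real.exp_le_exp]
      have h1 : κ * t ^ 2 + 1 / (4 * κ) * Z ω ^ 2 - t * Z ω = κ * (t - Z ω / (2 * κ)) ^ 2 := by
        field_simp
        ring
      have h2 : 0 ≤ κ * (t - Z ω / (2 * κ)) ^ 2 := by positivity
      linarith
    have hdom := hi.const_mul (Real.exp (κ * t ^ 2))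
    have hint : Integrable (fun ω => Real.exp (t * Z ω)) μ := by
      refine hdom.mono' (by fun_prop) (ae_of_all _ fun ω => ?_)
      rw [Real.norm_of_nonneg (Real.exp_nonneg _)]
      exact hpt ω
    refine ⟨hint, (integral_mono hint hdom hpt).trans ?_⟩
    rw [integral_const_mul]
    refine (mul_le_mul_of_nonneg_left hle (Real.exp_nonneg _)).trans ?_
    rw [← Real.exp_add, Real.exp_le_exp]
    have h3 : κ * (1 / (4 * κ)) = 1 / 4 := by field_simp
    have h4 : 1 / (4 * κ) ≤ 1 / 4 := by
      rw [one_div_le_one_div (by positivity) (by positivity)]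
      linarith
    change κ * t ^ 2 + (1 / (4 * κ) + 2 * (κ * (1 / (4 * κ))) ^ 2) ≤ _
    rw [h3]
    linarith

end Scalar

end SLRecovery

namespace SLRecovery

/-! ### Moment bounds common to the two row models -/

section Rows

variable {Ω : Type*} [MeasurableSpace Ω] {μ : Measure Ω} {ι : Type*} [Fintype ι]
  {a : Ω → ι → ℝ} {K : ℝ≥0}

/-- Exponential moment bounds at scale `C` for the marginals of a random vector, for their squares,
and for the squared length. -/
structure HasRowBounds (a : Ω → ι → ℝ) (μ : Measure Ω) (C : ℝ) : Prop where
  measurable : Measurable a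
  marginal : ∀ v, ∫⁻ ω, ENNReal.ofReal (Real.exp (a ω ⬝ᵥ v)) ∂μ ≤
    ENNReal.ofReal (Real.exp (C * (v ⬝ᵥ v)))
  marginal_sq : ∀ v s, v ⬝ᵥ v = 1 → C * |s| ≤ 1 →
    ∫⁻ ω, ENNReal.ofReal (Real.exp (s * (a ω ⬝ᵥ v) ^ 2)) ∂μ ≤
      ENNReal.ofReal (Real.exp (s + C * s ^ 2))
  normSq : ∀ s, C * |s| ≤ 1 → ∫⁻ ω, ENNReal.ofReal (Real.exp (s * (a ω ⬝ᵥ a ω))) ∂μ ≤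
    ENNReal.ofReal (Real.exp (Fintype.card ι * (s + C * s ^ 2)))

lemma dotProduct_self_nonneg (v : ι → ℝ) : 0 ≤ v ⬝ᵥ v :=
  Finset.sum_nonneg fun _ _ => mul_self_nonneg _

lemma measurable_dotProduct (v : ι → ℝ) : Measurable fun a : ι → ℝ => a ⬝ᵥ v := by
  unfold dotProduct
  fun_prop

lemma measurable_dotProduct_self : Measurable fun a : ι → ℝ => a ⬝ᵥ a := by
  unfold dotProduct
  fun_prop

lemma subGaussianNorm_dotProduct_le (h : subGaussianVecNorm a μ ≤ K) {v : ι → ℝ}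
    (hv : v ⬝ᵥ v = 1) : subGaussianNorm (fun ω => a ω ⬝ᵥ v) μ ≤ K := by
  have hv' : ‖WithLp.toLp 2 v‖ = 1 := by
    rw [← abs_of_nonneg (norm_nonneg (WithLp.toLp 2 v)), ← abs_one, ← sq_eq_sq_iff_abs_eq_abs,
      norm_toLp_sq, hv, one_pow]
  exact (le_iSup₂_of_le (f := fun (v : ι → ℝ) (_ : ‖WithLp.toLp 2 v‖ = 1) =>
    subGaussianNorm (fun ω => a ω ⬝ᵥ v) μ) v hv' le_rfl).trans h

section Isotropic

variable [DecidableEq ι]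

lemma IsIsotropic.memLp {ι : Type*} [DecidableEq ι] {a : Ω → ι → ℝ} (hm : Measurable a) (h : IsIsotropic a μ) (j : ι) :
    MemLp (fun ω => a ω j) 2 μ := by
  have hj : Measurable fun ω => a ω j := (measurable_pi_apply j).comp hm
  rw [memLp_two_iff_integrable_sq hj.aestronglyMeasurable]
  refine integrable_of_integral_eq_one ?_
  simpa [sq] using h j j

lemma IsIsotropic.integral_dotProduct_sq (hm : Measurable a) (h : IsIsotropic a μ) (v : ι → ℝ) :
    ∫ ω, (a ω ⬝ᵥ v) ^ 2 ∂μ = v ⬝ᵥ v := by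
  have hint : ∀ j k, Integrable (fun ω => a ω j * v j * (a ω k * v k)) μ := fun j k => by
    have := ((h.memLp hm j).integrable_mul (h.memLp hm k)).mul_const (v j * v k)
    refine this.congr (ae_of_all _ fun ω => ?_)
    simp only [Pi.mul_apply]
    ring
  have he : ∀ j k, ∫ ω, a ω j * v j * (a ω k * v k) ∂μ =
      (1 : Matrix ι ι ℝ) j k * (v j * v k) := fun j k => by
    rw [← h j k, ← integral_mul_const]
    congr 1
    ext ω
    ring
  simp_rw [dotProduct, sq, Finset.sum_mul_sum]
  rw [integral_finsetSum _ fun j _ => integrable_finsetSum _ fun k _ => hint j k]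
  refine Finset.sum_congr rfl fun j _ => ?_
  rw [integral_finsetSum _ fun k _ => hint j k]
  simp [he, Matrix.one_apply]

variable [IsProbabilityMeasure μ]

lemma IsIsotropic.integral_dotProduct (hm : Measurable a) (h : IsIsotropic a μ)
    (h0 : IsZeroMean a μ) (v : ι → ℝ) : ∫ ω, a ω ⬝ᵥ v ∂μ = 0 := by
  simp_rw [dotProduct]
  rw [integral_finsetSum _ fun j _ => ((h.memLp hm j).integrable one_le_two).mul_const (v j)]
  simp [integral_mul_const, h0 _]

lemma IsIsotropic.lintegral_marginal_sq (hm : Measurable a) (h : IsIsotropic a μ)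
    (hK : subGaussianVecNorm a μ ≤ K) {v : ι → ℝ} {s : ℝ} (hv : v ⬝ᵥ v = 1)
    (hs : 2 * subExpScale K ^ 2 * |s| ≤ 1) :
    ∫⁻ ω, ENNReal.ofReal (Real.exp (s * (a ω ⬝ᵥ v) ^ 2)) ∂μ ≤
      ENNReal.ofReal (Real.exp (s + 2 * subExpScale K ^ 2 * s ^ 2)) := by
  have hκ := one_le_subExpScale K
  have hs' : subExpScale K * |s| ≤ 1 / 2 := by
    nlinarith [mul_le_mul_of_nonneg_right hκ (mul_nonneg (by linarith : 0 ≤ subExpScale K)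
      (abs_nonneg s))]
  obtain ⟨hi, hle⟩ := integral_exp_mul_sq_le ((measurable_dotProduct v).comp hm)
    ((h.integral_dotProduct_sq hm v).trans hv) (subGaussianNorm_dotProduct_le hK hv) hs'
  rw [mul_pow, ← mul_assoc] at hle
  exact ofReal_integral_le_lintegral hi (fun _ => Real.exp_nonneg _) hle

lemma IsIsotropic.lintegral_marginal (hm : Measurable a) (h : IsIsotropic a μ)
    (h0 : IsZeroMean a μ) (hK : subGaussianVecNorm a μ ≤ K) (v : ι → ℝ) :
    ∫⁻ ω, ENNReal.ofReal (Real.exp (a ω ⬝ᵥ v)) ∂μ ≤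
      ENNReal.ofReal (Real.exp (2 * subExpScale K ^ 2 * (v ⬝ᵥ v))) := by
  have hκ := one_le_subExpScale K
  rcases eq_or_ne v 0 with rfl | hv
  · simp
  have hpos : 0 < v ⬝ᵥ v := lt_of_le_of_ne (dotProduct_self_nonneg v)
    fun h => hv (dotProduct_self_eq_zero.1 h.symm)
  set t := √(v ⬝ᵥ v) with ht
  have ht0 : 0 < t := Real.sqrt_pos.2 hpos
  have ht2 : t ^ 2 = v ⬝ᵥ v := Real.sq_sqrt hpos.le
  have hu : (t⁻¹ • v) ⬝ᵥ (t⁻¹ • v) = 1 := by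
    rw [smul_dotProduct, dotProduct_smul, ← ht2, smul_eq_mul, smul_eq_mul]
    field_simp
  obtain ⟨hi, hle⟩ := integral_exp_mul_le ((measurable_dotProduct (t⁻¹ • v)).comp hm)
    (h.integral_dotProduct hm h0 _) ((h.integral_dotProduct_sq hm _).trans hu)
    (subGaussianNorm_dotProduct_le hK hu) t
  have he : ∀ ω, t * (a ω ⬝ᵥ (t⁻¹ • v)) = a ω ⬝ᵥ v := fun ω => by
    rw [dotProduct_smul, smul_eq_mul, mul_inv_cancel_left₀ ht0.ne']
  simp only [Function.comp_def, he] at hi hle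
  refine ofReal_integral_le_lintegral hi (fun _ => Real.exp_nonneg _)
    (hle.trans (Real.exp_le_exp.2 ?_))
  rw [← ht2]
  gcongr
  nlinarith

end Isotropic

lemma IsIndepEntriesRow.isIsotropic {ι : Type*} [DecidableEq ι] {a : Ω → ι → ℝ}
    (hm : Measurable a) (h : IsIndepEntriesRow a μ) :
    IsIsotropic a μ := by
  intro j k
  have hmj : ∀ j, Measurable fun ω => a ω j := fun j => (measurable_pi_apply j).comp hm
  rcases eq_or_ne j k with rfl | hjk
  · have := h.unitVar j
    rw [variance_of_integral_eq_zero (hmj j).aemeasurable (h.zeroMean j)] at this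
    simpa [sq] using this
  · rw [Matrix.one_apply_ne hjk]
    have := (h.indep.indepFun hjk).integral_fun_mul_eq_mul_integral (hmj j).aestronglyMeasurable
      (hmj k).aestronglyMeasurable
    rw [this, h.zeroMean j, zero_mul]

variable [DecidableEq ι] [IsProbabilityMeasure μ]

/-- Here `|a|²` is almost surely constant, so `normSq` holds with no quadratic loss needed. -/
lemma IsSphericalRow.hasRowBounds (hm : Measurable a) (h : IsSphericalRow a μ)
    (hK : subGaussianVecNorm a μ ≤ K) : HasRowBounds a μ (2 * subExpScale K ^ 2) where
  measurable := hm
  marginal := h.isotropic.lintegral_marginal hm h.zeroMean hK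
  marginal_sq _ _ := h.isotropic.lintegral_marginal_sq hm hK
  normSq s _ := by
    have he : ∀ᵐ ω ∂μ, ENNReal.ofReal (Real.exp (s * (a ω ⬝ᵥ a ω))) =
        ENNReal.ofReal (Real.exp (Fintype.card ι * s)) := by
      filter_upwards [h.norm_eq] with ω hω
      rw [← norm_toLp_sq, hω, Real.sq_sqrt (by positivity), mul_comm]
    rw [lintegral_congr_ae he, lintegral_const, measure_univ, mul_one]
    refine ENNReal.ofReal_le_ofReal (Real.exp_le_exp.2 ?_)
    gcongr
    have : 0 ≤ 2 * subExpScale K ^ 2 * s ^ 2 := by positivity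
    linarith

/-- Independence factors the moment of `|a|²` over the entries, each being a marginal along a
coordinate vector. -/
lemma IsIndepEntriesRow.hasRowBounds (hm : Measurable a) (h : IsIndepEntriesRow a μ)
    (hK : subGaussianVecNorm a μ ≤ K) : HasRowBounds a μ (2 * subExpScale K ^ 2) where
  measurable := hm
  marginal := (h.isIsotropic hm).lintegral_marginal hm h.zeroMean hK
  marginal_sq _ _ := (h.isIsotropic hm).lintegral_marginal_sq hm hK
  normSq s hs := by
    have hmf : Measurable fun x : ℝ => ENNReal.ofReal (Real.exp (s * x ^ 2)) := by fun_prop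
    have he : ∀ ω, ENNReal.ofReal (Real.exp (s * (a ω ⬝ᵥ a ω))) =
        ∏ j, ENNReal.ofReal (Real.exp (s * a ω j ^ 2)) := fun ω => by
      rw [← ENNReal.ofReal_prod_of_nonneg fun _ _ => Real.exp_nonneg _, ← Real.exp_sum,
        ← Finset.mul_sum]
      simp [dotProduct, sq]
    simp_rw [he]
    rw [lintegral_prod_eq_prod_lintegral_of_indepFun Finset.univ
      (fun j ω => ENNReal.ofReal (Real.exp (s * a ω j ^ 2)))
      (h.indep.comp (fun _ x => ENNReal.ofReal (Real.exp (s * x ^ 2))) fun _ => hmf)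
      fun j => hmf.comp ((measurable_pi_apply j).comp hm)]
    rw [Real.exp_nat_mul, ENNReal.ofReal_pow (Real.exp_nonneg _), ← Finset.card_univ,
      ← Finset.prod_const]
    refine Finset.prod_le_prod' fun j _ => ?_
    have := (h.isIsotropic hm).lintegral_marginal_sq hm hK (v := Pi.single j 1) (by simp) hs
    simpa using this

end Rows

end SLRecovery

namespace SLRecovery

/-! ### Exponential moments of the squared length of a sum of rows -/

section Sums

variable {Ω : Type*} [MeasurableSpace Ω] {μ : Measure Ω}

lemma lintegral_comp_prodMk_of_indepFun {α β : Type*} [MeasurableSpace α] [MeasurableSpace β]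
    [IsProbabilityMeasure μ] {X : Ω → α} {Y : Ω → β} (hX : Measurable X) (hY : Measurable Y)
    (h : IndepFun X Y μ) {g : α × β → ℝ≥0∞} (hg : Measurable g) :
    ∫⁻ ω, g (X ω, Y ω) ∂μ = ∫⁻ ω', ∫⁻ ω, g (X ω', Y ω) ∂μ ∂μ := by
  have hmap := (indepFun_iff_map_prod_eq_prod_map_map hX.aemeasurable hY.aemeasurable).1 h
  have := Measure.isProbabilityMeasure_map (μ := μ) hY.aemeasurable
  rw [← lintegral_map hg (hX.prodMk hY), hmap, lintegral_prod _ hg.aemeasurable,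
    lintegral_map (hg.lintegral_prod_right') hX]
  exact lintegral_congr fun ω' => lintegral_map (hg.comp measurable_prodMk_left) hY

/-- The Cauchy-Schwarz inequality for exponential moments. -/
lemma lintegral_exp_add_le {u w : Ω → ℝ} (hu : Measurable u) (hw : Measurable w) {U W : ℝ}
    (hU : ∫⁻ ω, ENNReal.ofReal (Real.exp (2 * u ω)) ∂μ ≤ ENNReal.ofReal (Real.exp (2 * U)))
    (hW : ∫⁻ ω, ENNReal.ofReal (Real.exp (2 * w ω)) ∂μ ≤ ENNReal.ofReal (Real.exp (2 * W))) :
    ∫⁻ ω, ENNReal.ofReal (Real.exp (u ω + w ω)) ∂μ ≤ ENNReal.ofReal (Real.exp (U + W)) := by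
  -- Weighted arithmetic–geometric mean; the weights make both integrated terms at most `e ^ (U + W)
  -- / 2`.
  have hpt : ∀ ω, ENNReal.ofReal (Real.exp (u ω + w ω)) ≤
      ENNReal.ofReal (Real.exp (W - U) / 2) * ENNReal.ofReal (Real.exp (2 * u ω)) +
      ENNReal.ofReal (Real.exp (U - W) / 2) * ENNReal.ofReal (Real.exp (2 * w ω)) := by
    intro ω
    rw [← ENNReal.ofReal_mul (by positivity), ← ENNReal.ofReal_mul (by positivity),
      ← ENNReal.ofReal_add (by positivity) (by positivity)]
    refine ENNReal.ofReal_le_ofReal ?_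
    have h := two_mul_le_add_sq (Real.exp ((W - U) / 2 + u ω)) (Real.exp ((U - W) / 2 + w ω))
    rw [mul_assoc, ← Real.exp_add, ← Real.exp_nat_mul, ← Real.exp_nat_mul] at h
    rw [div_mul_eq_mul_div, div_mul_eq_mul_div, ← Real.exp_add, ← Real.exp_add]
    ring_nf at h ⊢
    linarith
  refine (lintegral_mono hpt).trans ?_
  rw [lintegral_add_left (by fun_prop), lintegral_const_mul _ (by fun_prop),
    lintegral_const_mul _ (by fun_prop)]
  refine (add_le_add (mul_le_mul_right hU _) (mul_le_mul_right hW _)).trans_eq ?_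
  rw [← ENNReal.ofReal_mul (by positivity), ← ENNReal.ofReal_mul (by positivity),
    ← ENNReal.ofReal_add (by positivity) (by positivity), div_mul_eq_mul_div, div_mul_eq_mul_div,
    ← Real.exp_add, ← Real.exp_add]
  ring_nf

variable {ι : Type*} [Fintype ι] {C : ℝ}

/-- Expand the square. Cauchy–Schwarz separates `|a|²` from the cross term `a·x`, whose sub-gaussian
bound is a multiple of `|x|²`. Adding a row thus only shifts the parameter `s` for the earlier sum
to `s + 8Cs²y²`. -/
lemma HasRowBounds.lintegral_add_smul {a : Ω → ι → ℝ} (h : HasRowBounds a μ C) (x : ι → ℝ)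
    {s y : ℝ} (hs : C * |2 * s * y ^ 2| ≤ 1) :
    ∫⁻ ω, ENNReal.ofReal (Real.exp (s * ((x + y • a ω) ⬝ᵥ (x + y • a ω)))) ∂μ ≤
      ENNReal.ofReal (Real.exp (Fintype.card ι * (s * y ^ 2 + 2 * C * s ^ 2 * y ^ 4))) *
        ENNReal.ofReal (Real.exp ((s + 8 * C * s ^ 2 * y ^ 2) * (x ⬝ᵥ x))) := by
  have hm := h.measurable
  have h1 := (measurable_dotProduct_self (ι := ι)).comp hm
  have h2 := (measurable_dotProduct x).comp hm
  have he : ∀ ω, ENNReal.ofReal (Real.exp (s * ((x + y • a ω) ⬝ᵥ (x + y • a ω)))) =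
      ENNReal.ofReal (Real.exp (s * (x ⬝ᵥ x))) *
      ENNReal.ofReal (Real.exp (s * y ^ 2 * (a ω ⬝ᵥ a ω) + 2 * s * y * (a ω ⬝ᵥ x))) := by
    intro ω
    rw [← ENNReal.ofReal_mul (Real.exp_nonneg _), ← Real.exp_add]
    congr 2
    simp only [add_dotProduct, dotProduct_add, smul_dotProduct, dotProduct_smul, smul_eq_mul,
      dotProduct_comm x (a ω)]
    ring
  simp_rw [he]
  rw [lintegral_const_mul _ (by
    refine ENNReal.measurable_ofReal.comp (Real.measurable_exp.comp ?_)
    exact (h1.const_mul _).add (h2.const_mul _))]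
  have hcs := lintegral_exp_add_le (μ := μ) (h1.const_mul (s * y ^ 2)) (h2.const_mul (2 * s * y))
    (U := Fintype.card ι * (s * y ^ 2 + 2 * C * s ^ 2 * y ^ 4))
    (W := 8 * C * s ^ 2 * y ^ 2 * (x ⬝ᵥ x)) (by
      refine le_trans (le_of_eq ?_) ((h.normSq _ hs).trans_eq ?_)
      · simp only [Function.comp_def]; ring_nf
      · ring_nf) (by
      refine le_trans (le_of_eq ?_) ((h.marginal ((4 * s * y) • x)).trans_eq ?_)
      · simp only [Function.comp_def, dotProduct_smul, smul_eq_mul]; ring_nf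
      · simp only [dotProduct_smul, smul_dotProduct, smul_eq_mul]; ring_nf)
  refine (mul_le_mul_right hcs _).trans_eq ?_
  rw [← ENNReal.ofReal_mul (by positivity), ← ENNReal.ofReal_mul (by positivity), ← Real.exp_add,
    ← Real.exp_add]
  ring_nf

/-- Bookkeeping for the induction on rows: the shifted parameter stays admissible because the range
`2 - t` widens by `y²` when the row is removed, and the growth of `t(1 + t)` pays for the
second-order errors. -/
lemma abs_exponent_step_le {s t y : ℝ} (hC : 0 < C) (ht0 : 0 ≤ t) (ht : y ^ 2 + t ≤ 1)
    (hs : 200 * C * |s| ≤ 2 - (y ^ 2 + t)) :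
    200 * C * |s + 8 * C * s ^ 2 * y ^ 2| ≤ 2 - t ∧
      s * y ^ 2 + 2 * C * s ^ 2 * y ^ 4 + ((s + 8 * C * s ^ 2 * y ^ 2) * t +
        20 * C * (s + 8 * C * s ^ 2 * y ^ 2) ^ 2 * (t * (1 + t))) ≤
      s * (y ^ 2 + t) + 20 * C * s ^ 2 * ((y ^ 2 + t) * (1 + (y ^ 2 + t))) := by
  set z := y ^ 2 with hz
  have hz0 : 0 ≤ z := sq_nonneg y
  have hz4 : y ^ 4 = z ^ 2 := by rw [hz]; ring
  rw [hz4]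
  have hCs : C * |s| ≤ 1 / 100 := by linarith
  have hCs0 : 0 ≤ C * |s| := by positivity
  have hss : s ^ 2 = |s| * |s| := by rw [← sq, sq_abs]
  have h1 : |s + 8 * C * s ^ 2 * z| ≤ |s| + 8 * C * s ^ 2 * z :=
    (abs_add_le _ _).trans_eq (by rw [abs_of_nonneg (by positivity : 0 ≤ 8 * C * s ^ 2 * z)])
  refine ⟨?_, ?_⟩
  · have h2 : 200 * C * (|s| + 8 * C * s ^ 2 * z) = 200 * C * |s| + 1600 * (C * |s|) ^ 2 * z := by
      rw [hss]; ring
    have h3 : 1600 * (C * |s|) ^ 2 * z ≤ z := by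
      have : 1600 * (C * |s|) ^ 2 ≤ 1 := by nlinarith
      nlinarith
    nlinarith [mul_le_mul_of_nonneg_left h1 (by positivity : 0 ≤ 200 * C)]
  · have h4 : (s + 8 * C * s ^ 2 * z) ^ 2 ≤ s ^ 2 * (1 + 18 / 100 * z) := by
      have h5 : C * s ≤ 1 / 100 := by nlinarith [le_abs_self s]
      have h6 : (C * s) ^ 2 ≤ 1 / 100 * (1 / 100) := by
        rw [show (C * s) ^ 2 = (C * |s|) * (C * |s|) by
          rw [mul_pow, hss]; ring]
        exact mul_le_mul hCs hCs hCs0 (by norm_num)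
      have h7 : (s + 8 * C * s ^ 2 * z) ^ 2 =
          s ^ 2 * (1 + 16 * (C * s) * z + 64 * (C * s) ^ 2 * z ^ 2) := by ring
      rw [h7]
      refine mul_le_mul_of_nonneg_left ?_ (sq_nonneg s)
      have hz1 : z ≤ 1 := by linarith
      have hz2 : z ^ 2 ≤ z := by nlinarith
      have h8 : 64 * (C * s) ^ 2 * z ^ 2 ≤ 64 * (1 / 100 * (1 / 100)) * z := by gcongr
      nlinarith
    have hq : 0 ≤ C * s ^ 2 := by positivity
    have htt : t * (1 + t) ≤ 2 := by nlinarith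
    have htt0 : 0 ≤ t * (1 + t) := by positivity
    have h9 : 20 * C * (s + 8 * C * s ^ 2 * z) ^ 2 * (t * (1 + t)) ≤
        C * s ^ 2 * (20 * (t * (1 + t)) + 36 / 5 * z) := by
      calc 20 * C * (s + 8 * C * s ^ 2 * z) ^ 2 * (t * (1 + t))
          ≤ 20 * C * (s ^ 2 * (1 + 18 / 100 * z)) * (t * (1 + t)) := by gcongr
        _ = C * s ^ 2 * (20 * (t * (1 + t)) + 18 / 5 * z * (t * (1 + t))) := by ring
        _ ≤ C * s ^ 2 * (20 * (t * (1 + t)) + 18 / 5 * z * 2) := by gcongr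
        _ = _ := by ring
    have h10 : 2 * z ^ 2 + 8 * z * t + 20 * (t * (1 + t)) + 36 / 5 * z ≤
        20 * ((z + t) * (1 + (z + t))) := by
      nlinarith [mul_nonneg hz0 ht0, sq_nonneg z]
    have h11 := mul_le_mul_of_nonneg_left h10 hq
    nlinarith

variable [IsProbabilityMeasure μ] {m : ℕ} {A : Ω → Matrix (Fin m) ι ℝ}

/-- The exponential moments of the squared length of a sum of independent rows. -/
lemma lintegral_exp_sum_rows_le (hC : 0 < C) (hA : ∀ i, HasRowBounds (fun ω => A ω i) μ C)
    (hind : iIndepFun (fun (i : Fin m) (ω : Ω) => A ω i) μ) (y : Fin m → ℝ) (F : Finset (Fin m)) :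
    ∀ s : ℝ, ∑ i ∈ F, y i ^ 2 ≤ 1 → 200 * C * |s| ≤ 2 - ∑ i ∈ F, y i ^ 2 →
      ∫⁻ ω, ENNReal.ofReal (Real.exp (s * ((∑ i ∈ F, y i • A ω i) ⬝ᵥ (∑ i ∈ F, y i • A ω i)))) ∂μ ≤
        ENNReal.ofReal (Real.exp (Fintype.card ι * (s * (∑ i ∈ F, y i ^ 2) + 20 * C * s ^ 2 *
          ((∑ i ∈ F, y i ^ 2) * (1 + ∑ i ∈ F, y i ^ 2))))) := by
  induction F using Finset.cons_induction with
  | empty => simp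
  | cons i F hi ih =>
    intro s hsum hs
    simp only [Finset.sum_cons] at hsum hs ⊢
    set t := ∑ i ∈ F, y i ^ 2 with ht
    have ht0 : 0 ≤ t := Finset.sum_nonneg fun _ _ => sq_nonneg _
    obtain ⟨hstep, hexp⟩ := abs_exponent_step_le hC ht0 hsum hs
    have hmS : Measurable fun ω => ∑ i ∈ F, y i • A ω i :=
      Finset.measurable_fun_sum _ fun i _ => (hA i).measurable.const_smul (y i)
    have hindS : IndepFun (fun ω => ∑ i ∈ F, y i • A ω i) (fun ω => A ω i) μ := by
      have h := hind.indepFun_finset F {i} (Finset.disjoint_singleton_right.2 hi)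
        fun i => (hA i).measurable
      have hφ : Measurable fun z : F → ι → ℝ => ∑ j : F, y j • z j :=
        Finset.measurable_fun_sum _ fun j _ => (measurable_pi_apply j).const_smul (y j)
      have hψ : Measurable fun z : ({i} : Finset (Fin m)) → ι → ℝ =>
          z ⟨i, Finset.mem_singleton_self i⟩ := measurable_pi_apply _
      have h' := h.comp hφ hψ
      convert h' using 1
      · ext1 ω
        exact (Finset.sum_coe_sort F fun j => y j • A ω j).symm
      · rfl
    have hg : Measurable fun p : (ι → ℝ) × (ι → ℝ) =>
        ENNReal.ofReal (Real.exp (s * ((p.1 + y i • p.2) ⬝ᵥ (p.1 + y i • p.2)))) := by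
      refine ENNReal.measurable_ofReal.comp (Real.measurable_exp.comp (Measurable.const_mul ?_ s))
      exact measurable_dotProduct_self.comp (measurable_fst.add (measurable_snd.const_smul (y i)))
    have hcomm : ∀ ω, y i • A ω i + ∑ i ∈ F, y i • A ω i = ∑ i ∈ F, y i • A ω i + y i • A ω i :=
      fun ω => add_comm _ _
    simp_rw [hcomm]
    -- Integrate out the new row with the earlier sum frozen, then apply the induction hypothesis at
    -- the shifted parameter.
    rw [lintegral_comp_prodMk_of_indepFun hmS (hA i).measurable hindS hg]
    have hsmall : C * |2 * s * y i ^ 2| ≤ 1 := by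
      rw [abs_mul, abs_mul, abs_of_nonneg (sq_nonneg (y i)), abs_two]
      nlinarith [mul_nonneg hC.le (abs_nonneg s), sq_nonneg (y i)]
    refine (lintegral_mono fun ω' => (hA i).lintegral_add_smul _ hsmall).trans ?_
    rw [lintegral_const_mul _ (by
      refine ENNReal.measurable_ofReal.comp (Real.measurable_exp.comp (Measurable.const_mul ?_ _))
      exact measurable_dotProduct_self.comp hmS)]
    refine (mul_le_mul_right (ih _ (by linarith [sq_nonneg (y i)]) hstep) _).trans ?_
    rw [← ENNReal.ofReal_mul (Real.exp_nonneg _), ← Real.exp_add]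
    refine ENNReal.ofReal_le_ofReal (Real.exp_le_exp.2 ?_)
    rw [← mul_add]
    gcongr

end Sums

end SLRecovery

namespace SLRecovery

/-! ### Chernoff bounds and the union bound over the net -/

section Tails

variable {Ω : Type*} [MeasurableSpace Ω] {μ : Measure Ω}

/-- The Chernoff bound. -/
lemma measure_le_of_lintegral_exp {X : Ω → ℝ} (hX : Measurable X) {B : ℝ} (c : ℝ)
    (h : ∫⁻ ω, ENNReal.ofReal (Real.exp (X ω)) ∂μ ≤ ENNReal.ofReal (Real.exp B)) :
    μ {ω | c ≤ X ω} ≤ ENNReal.ofReal (Real.exp (B - c)) := by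
  have hm := mul_meas_ge_le_lintegral (μ := μ) (f := fun ω => ENNReal.ofReal (Real.exp (X ω)))
    (by fun_prop) (ENNReal.ofReal (Real.exp c))
  have hset : {ω | ENNReal.ofReal (Real.exp c) ≤ ENNReal.ofReal (Real.exp (X ω))} =
      {ω | c ≤ X ω} := by
    ext ω
    simp [ENNReal.ofReal_le_ofReal_iff (Real.exp_nonneg _)]
  rw [hset] at hm
  rw [Real.exp_sub, ENNReal.ofReal_div_of_pos (Real.exp_pos _), ENNReal.le_div_iff_mul_le
    (Or.inl (by simp [Real.exp_pos])) (Or.inl ENNReal.ofReal_ne_top), mul_comm]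
  exact hm.trans h

variable {ι : Type*} [Fintype ι] {C : ℝ} {m : ℕ}
  {A : Ω → Matrix (Fin m) ι ℝ}

lemma measurable_vecMul_dotProduct_self (hA : ∀ i, Measurable fun ω => A ω i) (y : Fin m → ℝ) :
    Measurable fun ω => (y ᵥ* A ω) ⬝ᵥ (y ᵥ* A ω) := by
  simp_rw [Matrix.vecMul_eq_sum]
  exact measurable_dotProduct_self.comp
    (Finset.measurable_fun_sum _ fun i _ => (hA i).const_smul (y i))

/-- The squared length of a combination of the rows with unit coefficients concentrates around the
dimension. -/
lemma measure_vecMul_dotProduct_self_le [IsProbabilityMeasure μ] (hC : 0 < C)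
    (hA : ∀ i, HasRowBounds (fun ω => A ω i) μ C)
    (hind : iIndepFun (fun (i : Fin m) (ω : Ω) => A ω i) μ) {y : Fin m → ℝ} (hy : y ⬝ᵥ y = 1) :
    μ {ω | ¬ (9 / 10 * (Fintype.card ι : ℝ) ≤ (y ᵥ* A ω) ⬝ᵥ (y ᵥ* A ω) ∧
        (y ᵥ* A ω) ⬝ᵥ (y ᵥ* A ω) ≤ 11 / 10 * (Fintype.card ι : ℝ))} ≤
      ENNReal.ofReal (2 * Real.exp (-((Fintype.card ι : ℝ) / (16000 * C)))) := by
  set n : ℝ := (Fintype.card ι : ℝ)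
  have hsum : ∑ i, y i ^ 2 = 1 := by simpa [dotProduct, sq] using hy
  have hmeas := measurable_vecMul_dotProduct_self (fun i => (hA i).measurable) y
  -- The sign of `s` selects the tail. The exponent is `n(40Cs² - |s|/10)`, which equals
  -- `-n/(16000C)` for this `|s|`.
  have key : ∀ s : ℝ, |s| = 1 / (800 * C) →
      μ {ω | n * (s + |s| / 10) ≤ s * ((y ᵥ* A ω) ⬝ᵥ (y ᵥ* A ω))} ≤
        ENNReal.ofReal (Real.exp (-(n / (16000 * C)))) := by
    intro s hs
    have h := lintegral_exp_sum_rows_le hC hA hind y Finset.univ s hsum.le (by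
      rw [hsum, hs]
      field_simp
      norm_num)
    simp_rw [← Matrix.vecMul_eq_sum] at h
    rw [hsum] at h
    refine (measure_le_of_lintegral_exp (hmeas.const_mul s) _ h).trans_eq ?_
    rw [← sq_abs, hs]
    congr 2
    field_simp
    ring
  have hpos : 0 < 1 / (800 * C) := by positivity
  have h1 := key (1 / (800 * C)) (abs_of_pos hpos)
  have h2 := key (-(1 / (800 * C))) (by rw [abs_neg, abs_of_pos hpos])
  rw [two_mul, ENNReal.ofReal_add (Real.exp_nonneg _) (Real.exp_nonneg _)]
  refine (measure_mono ?_).trans ((measure_union_le _ _).trans (add_le_add h1 h2))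
  intro ω hω
  rw [Set.mem_ofPred_eq, not_and_or, not_le, not_le] at hω
  rcases hω with hω | hω
  · refine Or.inr ?_
    rw [Set.mem_ofPred_eq, abs_neg, abs_of_pos hpos]
    nlinarith
  · refine Or.inl ?_
    rw [Set.mem_ofPred_eq, abs_of_pos hpos]
    nlinarith

lemma measure_mulVec_dotProduct_self_ge_le (hC : 0 < C)
    (hA : ∀ i, HasRowBounds (fun ω => A ω i) μ C)
    (hind : iIndepFun (fun (i : Fin m) (ω : Ω) => A ω i) μ) {v : ι → ℝ} (hv : v ⬝ᵥ v = 1)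
    {M : ℝ} (hm : (m : ℝ) ≤ M) :
    μ {ω | 17 / 10 * M ≤ (A ω *ᵥ v) ⬝ᵥ (A ω *ᵥ v)} ≤
      ENNReal.ofReal (Real.exp (-(M / (10 * C)))) := by
  -- With this choice `s + Cs² = 3s/2`, below the threshold `17s/10` by `1/(10C)`.
  set s : ℝ := 1 / (2 * C) with hs
  have hs0 : 0 < s := by positivity
  have hCs : C * |s| ≤ 1 := by
    rw [abs_of_pos hs0, hs]
    field_simp
    norm_num
  have hrow : ∀ i, Measurable fun ω => A ω i ⬝ᵥ v := fun i =>
    (measurable_dotProduct v).comp (hA i).measurable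
  have hdot : ∀ ω, (A ω *ᵥ v) ⬝ᵥ (A ω *ᵥ v) = ∑ i, (A ω i ⬝ᵥ v) ^ 2 := fun ω => by
    simp [dotProduct, Matrix.mulVec, sq]
  have hE : ∫⁻ ω, ENNReal.ofReal (Real.exp (s * ∑ i, (A ω i ⬝ᵥ v) ^ 2)) ∂μ ≤
      ENNReal.ofReal (Real.exp (m * (s + C * s ^ 2))) := by
    have he : ∀ ω, ENNReal.ofReal (Real.exp (s * ∑ i, (A ω i ⬝ᵥ v) ^ 2)) =
        ∏ i, ENNReal.ofReal (Real.exp (s * (A ω i ⬝ᵥ v) ^ 2)) := fun ω => by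
      rw [← ENNReal.ofReal_prod_of_nonneg fun _ _ => Real.exp_nonneg _, ← Real.exp_sum,
        ← Finset.mul_sum]
    have hmf : Measurable fun x : ι → ℝ => ENNReal.ofReal (Real.exp (s * (x ⬝ᵥ v) ^ 2)) :=
      ENNReal.measurable_ofReal.comp (Real.measurable_exp.comp
        (((measurable_dotProduct v).pow_const 2).const_mul s))
    simp_rw [he]
    rw [lintegral_prod_eq_prod_lintegral_of_indepFun Finset.univ
      (fun i ω => ENNReal.ofReal (Real.exp (s * (A ω i ⬝ᵥ v) ^ 2)))
      (hind.comp (fun _ x => ENNReal.ofReal (Real.exp (s * (x ⬝ᵥ v) ^ 2))) fun _ => hmf)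
      fun i => hmf.comp (hA i).measurable]
    rw [Real.exp_nat_mul, ENNReal.ofReal_pow (Real.exp_nonneg _)]
    refine (Finset.prod_le_prod' fun i _ => (hA i).marginal_sq v s hv hCs).trans_eq ?_
    simp
  have hch := measure_le_of_lintegral_exp
    ((Finset.measurable_fun_sum Finset.univ fun i _ => (hrow i).pow_const 2).const_mul s)
    (s * (17 / 10 * M)) hE
  refine (measure_mono fun ω hω => ?_).trans (hch.trans (ENNReal.ofReal_le_ofReal
    (Real.exp_le_exp.2 ?_)))
  · rw [Set.mem_ofPred_eq, hdot] at hω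
    exact mul_le_mul_of_nonneg_left hω hs0.le
  · have h1 : (m : ℝ) * (s + C * s ^ 2) ≤ M * (s + C * s ^ 2) := by gcongr
    have h2 : M * (s + C * s ^ 2) - s * (17 / 10 * M) = -(M / (10 * C)) := by
      rw [hs]
      field_simp
      ring
    linarith

end Tails

lemma le_exp_five_mul (m : ℕ) : (101 : ℝ) ^ m ≤ Real.exp (5 * m) := by
  have h1 : (27 / 10 : ℝ) ≤ Real.exp 1 := by linarith [Real.exp_one_gt_d9]
  have h2 : (101 : ℝ) ≤ Real.exp 5 := by
    have := pow_le_pow_left₀ (by norm_num) h1 5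
    rw [← Real.exp_nat_mul] at this
    norm_num at this
    linarith
  rw [mul_comm, Real.exp_nat_mul]
  gcongr

/-- With high probability the transpose of the measurement matrix is bounded below. -/
lemma measure_not_lower_bound_le {Ω : Type*} [MeasurableSpace Ω] {μ : Measure Ω}
    [IsProbabilityMeasure μ] {ι : Type} [Fintype ι] {C : ℝ} {m : ℕ} {A : Ω → Matrix (Fin m) ι ℝ}
    (hC : 0 < C) (hA : ∀ i, HasRowBounds (fun ω => A ω i) μ C)
    (hind : iIndepFun (fun (i : Fin m) (ω : Ω) => A ω i) μ)
    (hm : (m : ℝ) ≤ 1 / (160000 * C) * Fintype.card ι) :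
    μ {ω | ¬ ∀ y : Fin m → ℝ, 17 / 20 * (Fintype.card ι : ℝ) * (y ⬝ᵥ y) ≤
        (y ᵥ* A ω) ⬝ᵥ (y ᵥ* A ω)} ≤
      ENNReal.ofReal (2 * Real.exp (-((Fintype.card ι : ℝ) / (32000 * C)))) := by
  obtain ⟨N, hcard, hunit, hN⟩ := exists_net_vecMul m
  set n : ℝ := (Fintype.card ι : ℝ) with hn
  have hsub : {ω | ¬ ∀ y : Fin m → ℝ, 17 / 20 * n * (y ⬝ᵥ y) ≤ (y ᵥ* A ω) ⬝ᵥ (y ᵥ* A ω)} ⊆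
      ⋃ y ∈ N, {ω | ¬ (9 / 10 * n ≤ (y ᵥ* A ω) ⬝ᵥ (y ᵥ* A ω) ∧
        (y ᵥ* A ω) ⬝ᵥ (y ᵥ* A ω) ≤ 11 / 10 * n)} := by
    intro ω hω
    by_contra hnot
    simp only [Set.mem_iUnion, Set.mem_ofPred_eq, not_exists, not_not] at hnot
    exact hω (hN (A ω) n (by positivity) hnot)
  refine (measure_mono hsub).trans ((measure_biUnion_finset_le _ _).trans ?_)
  refine (Finset.sum_le_sum fun y hy =>
    measure_vecMul_dotProduct_self_le hC hA hind (hunit y hy)).trans ?_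
  rw [Finset.sum_const, nsmul_eq_mul, ← ENNReal.ofReal_natCast, ← ENNReal.ofReal_mul (by positivity)]
  refine ENNReal.ofReal_le_ofReal ?_
  -- The bound on `m` lets the net's `e ^ (5m)` use up only half of the decay rate.
  calc (N.card : ℝ) * (2 * Real.exp (-(n / (16000 * C))))
      ≤ Real.exp (5 * m) * (2 * Real.exp (-(n / (16000 * C)))) := by
        gcongr
        exact hcard.trans (le_exp_five_mul m)
    _ = 2 * Real.exp (5 * m + -(n / (16000 * C))) := by rw [Real.exp_add]; ring
    _ ≤ 2 * Real.exp (-(n / (32000 * C))) := by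
        gcongr
        have : 5 * (1 / (160000 * C) * n) - n / (16000 * C) = -(n / (32000 * C)) := by
          field_simp
          ring
        linarith

end SLRecovery

/-! ### Combination of the two probability estimates -/

theorem mainTheorem7 (K : NNReal) :
    ∃ c₁ c₂ : ℝ, 0 < c₁ ∧ 0 < c₂ ∧
      ∀ (d k r : ℕ) (X₀ : Matrix (Fin d) (Fin d) ℝ),
        X₀ ≠ 0 → SLRecovery.IsSLMatrix X₀ k k r →
      ∀ (m : ℕ) (Ω : Type*) [MeasurableSpace Ω] (μ : MeasureTheory.Measure Ω)
        [MeasureTheory.IsProbabilityMeasure μ]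
        (A : Ω → Matrix (Fin m) (Fin d × Fin d) ℝ),
        SLRecovery.IsSubGaussianMeasurement A μ K →
      ∀ β : ℝ, 0 ≤ β → β ≤ 1 →
        (m : ℝ) ≤ min (SLRecovery.mLow β X₀) (c₁ * (d : ℝ) ^ 2) →
        1 - 4 * Real.exp (-c₂ * SLRecovery.mLow β X₀) ≤
          μ.real {ω | SLRecovery.ProgramFails (SLRecovery.weightedObjective β) (A ω) X₀} := by
  open SLRecovery in
  have hκ := one_le_subExpScale K
  set C : ℝ := 2 * subExpScale K ^ 2 with hCdef
  have hC : 0 < C := by positivity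
  -- `c₁` comes from the net's union bound; `c₂` from the rate `d²/(32000C)` there, rewritten with
  -- `m_low ≤ d²/2`.
  refine ⟨1 / (160000 * C), 1 / (16000 * C), by positivity, by positivity, ?_⟩
  intro d k r X₀ hX _ m Ω _ μ _ A hA β h0 h1 hm
  have hrows : ∀ i, HasRowBounds (fun ω => A ω i) μ C := fun i =>
    hA.form.elim (fun h => (h i).hasRowBounds (hA.measurable i) (hA.norm_le i))
      fun h => (h i).hasRowBounds (hA.measurable i) (hA.norm_le i)
  have hd : 0 < d := by
    rcases Nat.eq_zero_or_pos d with rfl | hd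
    · exact absurd (Subsingleton.elim X₀ 0) hX
    · exact hd
  have hcard : (Fintype.card (Fin d × Fin d) : ℝ) = (d : ℝ) ^ 2 := by
    simp [sq]
  have hd2 : (0 : ℝ) < (d : ℝ) ^ 2 := by positivity
  set M := mLow β X₀ with hM
  have hMle : M ≤ (d : ℝ) ^ 2 / 2 := mLow_le h0 h1 hX
  have hM0 : 0 ≤ M := (Nat.cast_nonneg m).trans (hm.trans (min_le_left _ _))
  have hv : (normalized X₀).vec ⬝ᵥ (normalized X₀).vec = 1 := by
    rw [vec_dotProduct_vec_self, frobNorm_normalized hX, one_pow]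
  have hE1 := measure_mulVec_dotProduct_self_ge_le hC hrows hA.indep hv (hm.trans (min_le_left _ _))
  have hE2 := measure_not_lower_bound_le hC hrows hA.indep
    (by rw [hcard]; exact hm.trans (min_le_right _ _))
  rw [hcard] at hE2
  set S := {ω | ProgramFails (weightedObjective β) (A ω) X₀} with hS
  have hcompl : Sᶜ ⊆ {ω | 17 / 10 * M ≤ (A ω *ᵥ (normalized X₀).vec) ⬝ᵥ
        (A ω *ᵥ (normalized X₀).vec)} ∪
      {ω | ¬ ∀ y : Fin m → ℝ, 17 / 20 * (d : ℝ) ^ 2 * (y ⬝ᵥ y) ≤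
        (y ᵥ* A ω) ⬝ᵥ (y ᵥ* A ω)} := by
    intro ω hω
    by_contra hnot
    simp only [Set.mem_union, Set.mem_ofPred_eq, not_or, not_le, not_not] at hnot
    refine hω (programFails_of_lower_bound h0 h1 (by positivity) hX (A ω) hnot.2 ?_)
    nlinarith [hnot.1]
  set q := Real.exp (-(1 / (16000 * C)) * M) with hq
  have hq1 : Real.exp (-(M / (10 * C))) ≤ q := by
    rw [hq, Real.exp_le_exp, neg_mul, neg_le_neg_iff, one_div_mul_eq_div]
    gcongr
    norm_num
  have hq2 : 2 * Real.exp (-((d : ℝ) ^ 2 / (32000 * C))) ≤ 2 * q := by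
    rw [hq]
    gcongr
    rw [neg_mul, neg_le_neg_iff, one_div_mul_eq_div]
    have : (d : ℝ) ^ 2 / (32000 * C) = (d : ℝ) ^ 2 / 2 / (16000 * C) := by
      field_simp
      norm_num
    rw [this]
    gcongr
  have hbad : μ Sᶜ ≤ ENNReal.ofReal (3 * q) := by
    refine (measure_mono hcompl).trans ((measure_union_le _ _).trans ((add_le_add hE1 hE2).trans ?_))
    rw [← ENNReal.ofReal_add (by positivity) (by positivity)]
    exact ENNReal.ofReal_le_ofReal (by linarith)
  have hbad' : μ.real Sᶜ ≤ 3 * q := ENNReal.toReal_le_of_le_ofReal (by positivity) hbad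
  -- Subadditivity alone suffices, so measurability of the failure event is not required.
  have hone : 1 ≤ μ.real S + μ.real Sᶜ := by
    have := measureReal_union_le (μ := μ) S Sᶜ
    rwa [Set.union_compl_self, probReal_univ] at this
  have hq0 : 0 < q := Real.exp_pos _
  linarith
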